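/- Let $p$ be a prime. A finite group $G$ acting on a finite set $\Omega$ has Property $(*)_p$ if, for every Sylow $p$-subgroup $P$ of $G$ and every $\omega\in\Omega$, the stabiliser $P_\omega$ is a Sylow $p$-subgroup of the stabiliser $G_\omega$. A group $G$ is almost simple if $T\leqslant G\leqslant \mathrm{Aut}(T)$ for some nonabelian simple group $T$ (identified with its group of inner automorphisms). A permutation group $G\leqslant\mathrm{Sym}(\Omega)$ is of affine type if $\Omega$ can be identified with a vector space $\mathbb{F}_r^d$, $r$ a prime, such that $G$ contains all translations and is contained in $\mathrm{AGL}_d(r)$. For $k\geqslant 2$, $H\leqslant\mathrm{Sym}(\Delta)$ and $K\leqslant S_k$, the wreath product $H\,\mathrm{wr}\,K=H^k\rtimes K$ acts on $\Delta^k$ in product action: $H^k$ acts coordinatewise and $K$ permutes the coordinates. Theorem. Let $G$ be a primitive permutation group on a finite nonempty set $\Omega$, let $p$ be a prime dividing $|\Omega|$, and suppose that $G$ has Property $(*)_p$. Then one of the following holds: (1) $G$ is an almost simple group; (2) $G$ is of affine type and $|\Omega|=p^k$ for some $k$; (3) $\Omega$ can be identified with $\Delta^k$ for some finite set $\Delta$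 and some $k\geqslant 2$ such that $G\leqslant H\,\mathrm{wr}\,K$ in product action, where $H\leqslant\mathrm{Sym}(\Delta)$ is an almost simple group acting primitively on $\Delta$ with Property $(*)_p$ and $K\leqslant S_k$; moreover, either $p$ is coprime to $|K|$, or $p$ divides $|K|$ and $|\Delta|$ is a power of $p$. Conversely, for every prime $p$, every primitive permutation group on a finite nonempty set that is as in (2) or (3) has Property $(*)_p$. -/

import Mathlib

universe u

/-- Property `(*)_p` for an action of `G` on `Ω`: for every Sylow `p`-subgroup `P` of `G` and every
point `ω`, the point stabiliser `P_ω = P ∩ G_ω` is a Sylow `p`-subgroup of `G_ω`. -/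
def HasPropertyStar (p : ℕ) (G Ω : Type*) [Group G] [MulAction G Ω] : Prop :=
  ∀ (P : Sylow p G) (ω : Ω), ∃ Q : Sylow p (MulAction.stabilizer G ω),
    (Q : Subgroup (MulAction.stabilizer G ω)) =
      (P : Subgroup G).subgroupOf (MulAction.stabilizer G ω)

/-- `G` is almost simple: `T ≤ G ≤ Aut(T)` for a nonabelian simple group `T`, where `T` is
identified with the group of its inner automorphisms. -/
def IsAlmostSimple (G : Type u) [Group G] : Prop :=
  ∃ (T : Type u) (_ : Group T), IsSimpleGroup T ∧ (∃ a b : T, a * b ≠ b * a) ∧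
    ∃ f : G →* MulAut T, Function.Injective f ∧ (MulAut.conj : T →* MulAut T).range ≤ f.range

/-- The permutation group `G` on `Ω` is of affine type: after identifying `Ω` with a vector space
`𝔽_r ^ d` for some prime `r`, the group `G` contains all translations and consists of
affine transformations. -/
def IsAffineType {Ω : Type*} (G : Subgroup (Equiv.Perm Ω)) : Prop :=
  ∃ (r d : ℕ) (_ : Fact r.Prime) (e : Ω ≃ (Fin d → ZMod r)),
    (∀ v : Fin d → ZMod r, (e.trans (Equiv.addRight v)).trans e.symm ∈ G) ∧
    ∀ g ∈ G, ∃ A : (Fin d → ZMod r) ≃ᵃ[ZMod r] (Fin d → ZMod r), ∀ ω, e (g ω) = A (e ω)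

/-- The permutation `(δ_i)_i ↦ (h_i (δ_{σ⁻¹ i}))_i` of `Δ^k`. -/
def productActionPerm {Δ : Type*} {k : ℕ} (h : Fin k → Equiv.Perm Δ) (σ : Equiv.Perm (Fin k)) :
    Equiv.Perm (Fin k → Δ) where
  toFun x i := h i (x (σ⁻¹ i))
  invFun x i := (h (σ i))⁻¹ (x (σ i))
  left_inv x := by ext i; simp
  right_inv x := by ext i; simp

/-- The wreath product `H Wr K = H^k ⋊ K` in its product action on `Δ^k`, as a group of
permutations of `Δ^k`. -/
def productActionWreath {Δ : Type*} {k : ℕ} (H : Subgroup (Equiv.Perm Δ))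
    (K : Subgroup (Equiv.Perm (Fin k))) : Subgroup (Equiv.Perm (Fin k → Δ)) where
  carrier := {g | ∃ (h : Fin k → Equiv.Perm Δ) (σ : Equiv.Perm (Fin k)),
    (∀ i, h i ∈ H) ∧ σ ∈ K ∧ g = productActionPerm h σ}
  one_mem' := ⟨fun _ => 1, 1, fun _ => H.one_mem, K.one_mem, by ext x i; simp [productActionPerm]⟩
  mul_mem' := by
    rintro _ _ ⟨h, σ, hh, hσ, rfl⟩ ⟨h', σ', hh', hσ', rfl⟩
    refine ⟨fun i => h i * h' (σ⁻¹ i), σ * σ', fun i => H.mul_mem (hh i) (hh' _),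
      K.mul_mem hσ hσ', ?_⟩
    ext x i
    simp [productActionPerm]
  inv_mem' := by
    rintro _ ⟨h, σ, hh, hσ, rfl⟩
    refine ⟨fun i => (h (σ i))⁻¹, σ⁻¹, fun i => H.inv_mem (hh _), K.inv_mem hσ, ?_⟩
    rw [inv_eq_iff_mul_eq_one]
    ext x i
    simp [productActionPerm]

/-- `Ω` can be identified with `Δ^k` for a finite set `Δ` and some `k ≥ 2` in such a way that
`G ≤ H Wr K` in product action, where `H ≤ Sym(Δ)` is an almost simple group acting primitively on
`Δ` with Property `(*)_p` and `K ≤ S_k`; moreover either `p` is coprime to `|K|`, or `p` divides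
`|K|` and `|Δ|` is a power of `p`. -/
def IsStarProductType {Ω : Type u} (p : ℕ) (G : Subgroup (Equiv.Perm Ω)) : Prop :=
  ∃ (k : ℕ) (Δ : Type u) (_ : Finite Δ) (e : Ω ≃ (Fin k → Δ))
    (H : Subgroup (Equiv.Perm Δ)) (K : Subgroup (Equiv.Perm (Fin k))),
    2 ≤ k ∧
    (∀ g ∈ G, (e.symm.trans g).trans e ∈ productActionWreath H K) ∧
    IsAlmostSimple H ∧ MulAction.IsPreprimitive H Δ ∧ HasPropertyStar p H Δ ∧
    (Nat.Coprime p (Nat.card K) ∨ (p ∣ Nat.card K ∧ ∃ a : ℕ, Nat.card Δ = p ^ a))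

/-! For transitive `G`, comparing two factorisations of the index of `P_ω` turns Property `(*)_p`
into a statement about orbits alone: every orbit of a `p`-subgroup has length dividing `|Ω|`. In
this form it passes to transitive subgroups, and it forces a Sylow `p`-subgroup of a transitive
subgroup to have the same orbits as any `p`-group above it.

Let `M` be a minimal normal subgroup. If `M` is abelian, it is regular and elementary abelian, so
`G` is affine. Otherwise `M` is generated by the commuting conjugates of a nonabelian simple group
`T`. Write `X` for the normaliser of `T`, and regard `conjAgree S T` as the projection of `S` to
`T`.

The decisive point is `HasPropertyStar.not_le_conjAgree`: point stabilisers do not project onto `T`.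
If one did, it would meet `T` trivially, and the property would make its Sylow `p`-subgroup in `X`
centralise `T`, although it must induce a group of order divisible by `p` on `T`. This excludes
diagonal and regular actions of `M`.

Maximality of `G_ω` then puts its projections to all conjugates of `T` inside `G_ω`
(`ConjugatesCommute.conjAgree_le`), so `Ω` is a product over these conjugates, with factor `Δ` the
set of orbits of the centraliser of `T`. If `X = G`, the group is almost simple; otherwise `X`
induces on `Δ` an almost simple primitive group with the property. When `p` divides the order of the
group permuting the factors, comparing Sylow orbits in `M` and in `G` makes a `p`-group transitive
on `Δ`.

Conversely, `p`-groups have orbits of `p`-power length, so it is enough to bound these lengths by a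
divisor of `|Ω|` that is itself a power of `p`. -/

open MulAction
open scoped Pointwise

/-! ### Property `(*)_p` in terms of orbits of `p`-subgroups -/

section Star

variable {p : ℕ} {G Ω : Type*} [Group G] [MulAction G Ω]

theorem hasPropertyStar_iff_not_dvd_relIndex [Finite G] (hp : p.Prime) :
    HasPropertyStar p G Ω ↔
      ∀ (P : Sylow p G) (ω : Ω), ¬ p ∣ (P : Subgroup G).relIndex (stabilizer G ω) := by
  have := Fact.mk hp
  refine forall₂_congr fun P ω => ⟨?_, fun h => ?_⟩
  · rintro ⟨Q, hQ⟩
    rw [Subgroup.relIndex, ← hQ]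
    exact Q.not_dvd_index
  · exact ⟨(P.isPGroup'.comap_subtype).toSylow h, rfl⟩

/-- Both sides equal the index in `G` of `P_ω`, computed through `P` and through `G_ω`. -/
theorem index_mul_ncard_orbit [IsPretransitive G Ω] (P : Subgroup G) (ω : Ω) :
    P.index * (orbit P ω).ncard = Nat.card Ω * P.relIndex (stabilizer G ω) := by
  have h1 : (orbit P ω).ncard = (stabilizer G ω).relIndex P := by
    rw [← index_stabilizer]; rfl
  rw [h1, ← index_stabilizer_of_transitive G ω, mul_comm, ← Subgroup.inf_relIndex_right,
    Subgroup.relIndex_mul_index inf_le_right, mul_comm, ← Subgroup.inf_relIndex_right,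
    Subgroup.relIndex_mul_index inf_le_right, inf_comm]

theorem ncard_orbit_eq_pow [Finite G] (hp : p.Prime) {P : Subgroup G} (hP : IsPGroup p P) (ω : Ω) :
    ∃ n : ℕ, (orbit P ω).ncard = p ^ n := by
  have := Fact.mk hp
  obtain ⟨n, hn⟩ := hP.index (stabilizer P ω)
  exact ⟨n, by rw [← hn, index_stabilizer]⟩

theorem orbit_subset_of_le {P Q : Subgroup G} (h : P ≤ Q) (ω : Ω) : orbit P ω ⊆ orbit Q ω := by
  rintro _ ⟨g, rfl⟩
  exact ⟨⟨g, h g.2⟩, rfl⟩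

/-- By `index_mul_ncard_orbit`, with `p` prime to the index of a Sylow subgroup `P`, the orbit of
`P` has length at least the `p`-part of `|Ω|`, with equality exactly when `p` does not divide the
index of `P_ω` in `G_ω`. Smaller `p`-groups have shorter orbits, again of `p`-power length. -/
theorem hasPropertyStar_iff_ncard_orbit_dvd [Finite G] [Finite Ω] [IsPretransitive G Ω]
    (hp : p.Prime) :
    HasPropertyStar p G Ω ↔
      ∀ (P : Subgroup G) (ω : Ω), IsPGroup p P → (orbit P ω).ncard ∣ Nat.card Ω := by
  have := Fact.mk hp
  rw [hasPropertyStar_iff_not_dvd_relIndex hp]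
  constructor
  · intro h P ω hP
    obtain ⟨Q, hQ⟩ := hP.exists_le_sylow
    obtain ⟨n, hn⟩ := ncard_orbit_eq_pow hp hP ω
    obtain ⟨m, hm⟩ := ncard_orbit_eq_pow hp Q.isPGroup' ω
    have h1 : (orbit P ω).ncard ≤ (orbit Q ω).ncard :=
      Set.ncard_le_ncard (orbit_subset_of_le hQ ω) (Set.toFinite _)
    rw [hn, hm, Nat.pow_le_pow_iff_right hp.one_lt] at h1
    have h2 : p ^ m ∣ Nat.card Ω * (Q : Subgroup G).relIndex (stabilizer G ω) := by
      rw [← index_mul_ncard_orbit, hm]; exact dvd_mul_left _ _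
    rw [hn]
    exact (pow_dvd_pow p h1).trans
      ((Nat.Coprime.pow_left m ((Nat.Prime.coprime_iff_not_dvd hp).2 (h Q ω))).dvd_of_dvd_mul_right h2)
  · intro h P ω hd
    have : Nonempty Ω := ⟨ω⟩
    obtain ⟨c, hc⟩ := h P ω P.isPGroup'
    obtain ⟨d, hd⟩ := hd
    have h1 := index_mul_ncard_orbit (P : Subgroup G) ω
    have h0 : 0 < (orbit P ω).ncard :=
      (Set.ncard_pos (Set.toFinite _)).2 (nonempty_orbit ω)
    rw [hc, hd] at h1
    apply P.not_dvd_index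
    refine ⟨c * d, Nat.eq_of_mul_eq_mul_right h0 ?_⟩
    rw [h1]; ring

/-- A `p`-subgroup of `X` is a `p`-subgroup of `G` with the same orbits, and the orbit criterion
mentions nothing else. -/
theorem HasPropertyStar.subgroup [Finite G] [Finite Ω] (hp : p.Prime) (h : HasPropertyStar p G Ω)
    (X : Subgroup G) [IsPretransitive X Ω] : HasPropertyStar p X Ω := by
  have : IsPretransitive G Ω := IsPretransitive.of_smul_eq (M := X) (fun x => (x : G)) rfl
  rw [hasPropertyStar_iff_ncard_orbit_dvd hp] at h ⊢
  intro P ω hP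
  convert h (P.map X.subtype) ω (hP.map _) using 2
  ext y
  constructor
  · rintro ⟨g, rfl⟩
    exact ⟨⟨g.1.1, g.1, g.2, rfl⟩, rfl⟩
  · rintro ⟨⟨_, g, hg, rfl⟩, rfl⟩
    exact ⟨⟨g, hg⟩, rfl⟩

/-- A Sylow `p`-subgroup of a transitive subgroup has the same orbits as any `p`-group
containing it. -/
theorem HasPropertyStar.orbit_eq [Finite G] [Finite Ω] (hp : p.Prime) (h : HasPropertyStar p G Ω)
    {X : Subgroup G} [IsPretransitive X Ω] (Q : Sylow p X) {P : Subgroup G} (hP : IsPGroup p P)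
    (hQP : (Q : Subgroup X).map X.subtype ≤ P) (ω : Ω) :
    orbit P ω = orbit Q ω := by
  have := Fact.mk hp
  have : IsPretransitive G Ω := IsPretransitive.of_smul_eq (M := X) (fun x => (x : G)) rfl
  rw [hasPropertyStar_iff_ncard_orbit_dvd hp] at h
  symm
  apply Set.eq_of_subset_of_ncard_le _ _ (Set.toFinite _)
  · rintro _ ⟨g, rfl⟩
    exact ⟨⟨g.1.1, hQP ⟨g.1, g.2, rfl⟩⟩, rfl⟩
  · obtain ⟨n, hn⟩ := ncard_orbit_eq_pow hp hP ω
    have h1 : p ^ n ∣ (Q : Subgroup X).index * (orbit Q ω).ncard := by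
      rw [index_mul_ncard_orbit, ← hn]
      exact dvd_mul_of_dvd_left (h P ω hP) _
    have h2 := (Nat.Coprime.pow_left n
      ((Nat.Prime.coprime_iff_not_dvd hp).2 Q.not_dvd_index)).dvd_of_dvd_mul_left h1
    rw [hn]
    exact Nat.le_of_dvd ((Set.ncard_pos (Set.toFinite _)).2 (nonempty_orbit ω)) h2

theorem relIndex_map_dvd {H : Type*} [Group H] (f : G →* H) (P S : Subgroup G) :
    (P.map f).relIndex (S.map f) ∣ P.relIndex S := by
  refine (Subgroup.index_dvd_of_le ?_).trans
    (Subgroup.index_map_dvd (P.subgroupOf S) (f.subgroupMap_surjective S))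
  rintro _ ⟨x, hx, rfl⟩
  exact ⟨x, hx, rfl⟩

/-- Property `(*)_p` passes to quotient actions whose point stabilisers are images of point
stabilisers. -/
theorem HasPropertyStar.of_surjective {H Δ : Type*} [Group H] [MulAction H Δ] [Finite G]
    (hp : p.Prime) (h : HasPropertyStar p G Ω) {f : G →* H} (hf : Function.Surjective f)
    {φ : Ω → Δ} (hφ : Function.Surjective φ)
    (hs : ∀ ω, stabilizer H (φ ω) = (stabilizer G ω).map f) : HasPropertyStar p H Δ := by
  have := Fact.mk hp
  have : Finite H := Finite.of_surjective f hf
  rw [hasPropertyStar_iff_not_dvd_relIndex hp] at h ⊢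
  intro P δ hd
  obtain ⟨P, rfl⟩ := Sylow.mapSurjective_surjective hf p P
  obtain ⟨ω, rfl⟩ := hφ δ
  refine h P ω (hd.trans ?_)
  rw [hs, Sylow.coe_mapSurjective]
  exact relIndex_map_dvd f _ _

end Star

/-! ### The converse: degree a power of `p`, and product actions -/

section Converse

variable {p : ℕ} {Ω : Type*} [Finite Ω] {G : Subgroup (Equiv.Perm Ω)}

theorem hasPropertyStar_of_card_eq_pow [IsPretransitive G Ω] (hp : p.Prime) {k : ℕ}
    (h : Nat.card Ω = p ^ k) : HasPropertyStar p G Ω := by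
  rw [hasPropertyStar_iff_ncard_orbit_dvd hp]
  intro P ω hP
  obtain ⟨n, hn⟩ := ncard_orbit_eq_pow hp hP ω
  have h1 := Set.ncard_le_card (orbit P ω)
  rw [hn, h, Nat.pow_le_pow_iff_right hp.one_lt] at h1
  rw [hn, h]
  exact pow_dvd_pow p h1

theorem pow_mem_productActionWreath_bot {Δ : Type*} {k : ℕ} {H : Subgroup (Equiv.Perm Δ)}
    {K : Subgroup (Equiv.Perm (Fin k))} {g : Equiv.Perm (Fin k → Δ)}
    (hg : g ∈ productActionWreath H K) {m : ℕ} (hm : ∀ σ ∈ K, σ ^ m = 1) :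
    g ^ m ∈ productActionWreath H ⊥ := by
  obtain ⟨h, σ, hh, hσ, rfl⟩ := hg
  have key : ∀ n : ℕ, ∃ h' : Fin k → Equiv.Perm Δ, (∀ i, h' i ∈ H) ∧
      productActionPerm h σ ^ n = productActionPerm h' (σ ^ n) := by
    intro n
    induction n with
    | zero => exact ⟨1, fun _ => H.one_mem, by ext x i; simp [productActionPerm]⟩
    | succ n ih =>
      obtain ⟨h', hh', e⟩ := ih
      refine ⟨fun i => h' i * h ((σ ^ n)⁻¹ i), fun i => H.mul_mem (hh' i) (hh _), ?_⟩
      rw [pow_succ, e]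
      ext x i
      simp [productActionPerm, pow_succ]
  obtain ⟨h', hh', e⟩ := key m
  exact ⟨h', σ ^ m, hh', by rw [hm σ hσ]; exact Subgroup.one_mem _, e⟩

theorem IsStarProductType.hasPropertyStar {Ω : Type u} [Finite Ω] [Nonempty Ω]
    {G : Subgroup (Equiv.Perm Ω)} [IsPretransitive G Ω] (hp : p.Prime)
    (h : IsStarProductType p G) : HasPropertyStar p G Ω := by
  obtain ⟨k, Δ, _, e, H, K, -, hGe, -, hprim, hstar, hK⟩ := h
  have := Fact.mk hp
  have hcard : Nat.card Ω = Nat.card Δ ^ k := by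
    rw [Nat.card_congr e, Nat.card_fun, Nat.card_fin]
  rcases hK with hK | ⟨-, a, ha⟩
  swap
  · exact hasPropertyStar_of_card_eq_pow hp (k := a * k) (by rw [hcard, ha, pow_mul])
  have := hprim.toIsPretransitive
  rw [hasPropertyStar_iff_ncard_orbit_dvd hp] at hstar ⊢
  intro P ω hP
  -- The order of `g` is prime to `|K|`, so `g` is a `|K|`-th power of an element of `G`. Such
  -- powers induce the identity on the coordinates, so `g` lies in the base group.
  have base : ∀ g ∈ P, ∃ h : Fin k → Equiv.Perm Δ, (∀ i, h i ∈ H) ∧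
      ∀ ω i, e ((g : Equiv.Perm Ω) ω) i = h i (e ω i) := by
    intro g hg
    obtain ⟨n, hn⟩ := hP ⟨g, hg⟩
    have hn : g ^ p ^ n = 1 := congrArg Subtype.val hn
    have hcop : Nat.Coprime (p ^ n) (Nat.card K) := Nat.Coprime.pow_left n hK
    obtain ⟨m, hm⟩ := exists_pow_eq_self_of_coprime (x := g) (n := Nat.card K)
      (hcop.symm.coprime_dvd_right (orderOf_dvd_of_pow_eq_one hn))
    have h1 := hGe (g ^ m) (G.pow_mem g.2 m)
    have h2 := pow_mem_productActionWreath_bot h1 (m := Nat.card K) fun σ hσ => by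
      have := pow_card_eq_one' (x := (⟨σ, hσ⟩ : K))
      exact congrArg Subtype.val this
    have h3 : ((e.symm.trans ((g : Equiv.Perm Ω) ^ m)).trans e) ^ Nat.card K =
        (e.symm.trans (g : Equiv.Perm Ω)).trans e := by
      have : ∀ x : Equiv.Perm Ω, (e.symm.trans x).trans e = e.permCongrHom x := fun _ => rfl
      rw [this, this, ← map_pow]
      congr 1
      rw [← pow_mul, mul_comm, pow_mul]
      exact congrArg Subtype.val hm
    rw [h3] at h2
    obtain ⟨h, σ, hh, hσ, he⟩ := h2
    obtain rfl : σ = 1 := hσ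
    refine ⟨h, hh, fun ω i => ?_⟩
    have := congrFun (congrArg (fun f => f (e ω)) he) i
    simpa [productActionPerm] using this
  obtain ⟨n, hn⟩ := ncard_orbit_eq_pow hp hP ω
  have surj : ∀ (i : Fin k) (y : Δ), ∃ ω, e ω i = y := fun i y =>
    ⟨e.symm fun _ => y, by simp⟩
  -- `R i` is the projection of `P` to the `i`-th coordinate. The orbit of `P` lies in the product
  -- of the orbits of the `R i`, whose size is a power of `p` dividing `|Δ|^k`.
  let R (i : Fin k) : Subgroup H :=
    { carrier := {x | ∃ g ∈ P, ∀ ω, e ((g : Equiv.Perm Ω) ω) i = (x : Equiv.Perm Δ) (e ω i)}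
      one_mem' := ⟨1, P.one_mem, fun _ => rfl⟩
      mul_mem' := by
        rintro x y ⟨g, hg, hx⟩ ⟨g', hg', hy⟩
        refine ⟨g * g', P.mul_mem hg hg', fun ω => ?_⟩
        simp [hx, hy]
      inv_mem' := by
        rintro x ⟨g, hg, hx⟩
        refine ⟨g⁻¹, P.inv_mem hg, fun ω => ?_⟩
        apply (x : Equiv.Perm Δ).injective
        rw [← hx]
        simp }
  have hR : ∀ i, IsPGroup p (R i) := by
    rintro i ⟨x, g, hg, hx⟩
    obtain ⟨n, hn⟩ := hP ⟨g, hg⟩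
    have hn : (g : Equiv.Perm Ω) ^ p ^ n = 1 :=
      congrArg (fun z : P => ((z : G) : Equiv.Perm Ω)) hn
    refine ⟨n, Subtype.ext (Subtype.ext (Equiv.ext fun y => ?_))⟩
    obtain ⟨ω, rfl⟩ := surj i y
    have key : ∀ m : ℕ, e (((g : Equiv.Perm Ω) ^ m) ω) i = ((x : Equiv.Perm Δ) ^ m) (e ω i) := by
      intro m
      induction m with
      | zero => rfl
      | succ m ih => rw [pow_succ', pow_succ', Equiv.Perm.mul_apply, hx, ih]; rfl
    have := key (p ^ n)
    rw [hn] at this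
    exact this.symm
  choose m hm using fun i => ncard_orbit_eq_pow hp (hR i) (e ω i)
  have hle : (orbit P ω).ncard ≤ ∏ i, (orbit (R i) (e ω i)).ncard := by
    have h1 : (orbit P ω).ncard = (e '' orbit P ω).ncard :=
      (Set.ncard_image_of_injective _ e.injective).symm
    have h2 : e '' orbit P ω ⊆ Set.univ.pi fun i => orbit (R i) (e ω i) := by
      rintro _ ⟨_, ⟨g, rfl⟩, rfl⟩ i -
      obtain ⟨h, hh, hg⟩ := base g g.2
      exact ⟨⟨⟨h i, hh i⟩, g.1, g.2, fun ω => hg ω i⟩, (hg ω i).symm⟩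
    have h3 : (Set.univ.pi fun i => orbit (R i) (e ω i)).ncard =
        ∏ i, (orbit (R i) (e ω i)).ncard := by
      rw [← Nat.card_coe_set_eq, Nat.card_congr (Equiv.Set.univPi _), Nat.card_pi]
      simp only [Nat.card_coe_set_eq]
    rw [h1, ← h3]
    exact Set.ncard_le_ncard h2 (Set.toFinite _)
  have hdvd : ∏ i, (orbit (R i) (e ω i)).ncard ∣ Nat.card Ω := by
    rw [hcard, ← Fin.prod_const]
    exact Finset.prod_dvd_prod_of_dvd _ _ fun i _ => hstar (R i) (e ω i) (hR i)
  simp only [hm] at hle hdvd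
  rw [Finset.prod_pow_eq_pow_sum] at hle hdvd
  rw [hn] at hle ⊢
  rw [Nat.pow_le_pow_iff_right hp.one_lt] at hle
  exact (pow_dvd_pow p hle).trans hdvd

end Converse

/-! ### Abelian minimal normal subgroups -/

section Affine

variable {Ω : Type*} [Finite Ω] {G : Subgroup (Equiv.Perm Ω)}

/-- A transitive abelian permutation group is regular, so the orbit map of `ω₀` identifies `Ω` with
`M` as a vector space. Elements of `M` become translations, and `g` becomes conjugation by `g`
followed by the translation taking `ω₀` to `g ω₀`. -/
theorem isAffineType_of_elementary_abelian [Nonempty Ω] {r : ℕ} (hr : r.Prime) (M : Subgroup G) [M.Normal]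
    [IsPretransitive M Ω] (hcomm : ∀ a b : M, a * b = b * a) (hexp : ∀ a : M, a ^ r = 1) :
    IsAffineType G ∧ ∃ d : ℕ, Nat.card Ω = r ^ d := by
  have := Fact.mk hr
  let _ : CommGroup M := { (inferInstance : Group M) with mul_comm := hcomm }
  let _ : Module (ZMod r) (Additive M) := AddCommGroup.zmodModule (n := r) hexp
  let ω₀ : Ω := Classical.arbitrary Ω
  have hbij : Function.Bijective fun m : Additive M => m.toMul • ω₀ := by
    refine ⟨fun a b (hab : a.toMul • ω₀ = b.toMul • ω₀) => ?_, fun ω => ?_⟩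
    · refine Additive.toMul.injective (Subtype.ext (Subtype.ext (Equiv.ext fun ω => ?_)))
      obtain ⟨c, rfl⟩ := exists_smul_eq M ω₀ ω
      change a.toMul • c • ω₀ = b.toMul • c • ω₀
      rw [smul_smul, hcomm, mul_smul, hab, smul_smul, hcomm, mul_smul]
    · obtain ⟨c, hc⟩ := exists_smul_eq M ω₀ ω
      exact ⟨Additive.ofMul c, hc⟩
  have : Module.Finite (ZMod r) (Additive M) := Module.Finite.of_finite
  let e₀ := (Module.finBasis (ZMod r) (Additive M)).equivFun
  let E := Equiv.ofBijective _ hbij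
  let e := E.symm.trans e₀.toEquiv
  have hE : ∀ a b : M, E.symm (a • E (Additive.ofMul b)) = Additive.ofMul a + Additive.ofMul b := by
    intro a b
    rw [Equiv.symm_apply_eq]
    exact smul_smul a b ω₀
  refine ⟨⟨r, _, ‹_›, e, fun v => ?_, fun g hg => ?_⟩, Module.finrank (ZMod r) (Additive M), ?_⟩
  · have : (e.trans (Equiv.addRight v)).trans e.symm = ((e₀.symm v).toMul : Equiv.Perm Ω) := by
      refine Equiv.ext fun ω => ?_
      obtain ⟨b, rfl⟩ := E.surjective ω
      simp only [Equiv.trans_apply, Equiv.symm_apply_eq, Equiv.coe_addRight]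
      have h1 := hE (e₀.symm v).toMul b.toMul
      change e₀ (E.symm (E b)) + v = e₀ (E.symm ((e₀.symm v).toMul • E (Additive.ofMul b.toMul)))
      rw [h1, map_add, E.symm_apply_apply]
      simp [add_comm]
    rw [this]
    exact (e₀.symm v).toMul.1.2
  · let c : Additive M ≃+ Additive M := MulEquiv.toAdditive (MulAut.conjNormal (H := M) ⟨g, hg⟩)
    let cl : Additive M ≃ₗ[ZMod r] Additive M :=
      { c with map_smul' := fun a x => ZMod.map_smul c a x }
    obtain ⟨n, hn⟩ := E.surjective (g ω₀)
    refine ⟨(e₀.symm.trans (cl.trans e₀)).toAffineEquiv.trans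
      (AffineEquiv.constVAdd _ _ (e₀ n)), fun ω => ?_⟩
    obtain ⟨b, rfl⟩ := E.surjective ω
    have h1 : g (E b) = E (n + c b) := by
      have h2 : (n.toMul : Equiv.Perm Ω) ω₀ = g ω₀ := hn
      have h3 : (((c b).toMul : G) : Equiv.Perm Ω) = g * b.toMul * g⁻¹ := rfl
      rw [add_comm]
      change g ((b.toMul : Equiv.Perm Ω) ω₀) =
        (((c b).toMul : G) : Equiv.Perm Ω) ((n.toMul : Equiv.Perm Ω) ω₀)
      rw [h2, h3]
      simp
    change e₀ (E.symm (g (E b))) = e₀ n + e₀ (c (e₀.symm (e₀ (E.symm (E b)))))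
    rw [h1]
    simp
  · rw [Nat.card_congr e]
    simp

end Affine

/-! ### Nonabelian simple groups -/

section SimpleGroup

variable {A : Type*} [Group A] [IsSimpleGroup A]

theorem IsSimpleGroup.center_eq_bot (h : ∃ a b : A, a * b ≠ b * a) : Subgroup.center A = ⊥ := by
  obtain ⟨a, b, hab⟩ := h
  refine (IsSimpleGroup.eq_bot_or_eq_top_of_normal _ inferInstance).resolve_right fun h => hab ?_
  exact ((Subgroup.mem_center_iff.1 (h ▸ Subgroup.mem_top a : a ∈ Subgroup.center A)) b).symm

theorem IsSimpleGroup.conj_injective (h : ∃ a b : A, a * b ≠ b * a) :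
    Function.Injective (MulAut.conj : A →* MulAut A) := by
  rw [injective_iff_map_eq_one]
  intro a ha
  rw [← Subgroup.mem_bot, ← IsSimpleGroup.center_eq_bot h, Subgroup.mem_center_iff]
  intro b
  have := DFunLike.congr_fun ha b
  simp only [MulAut.conj_apply, MulAut.one_apply] at this
  rw [mul_inv_eq_iff_eq_mul] at this
  exact this.symm

theorem IsSimpleGroup.eq_bot_of_normal_of_isPGroup [Finite A] {p : ℕ} (hp : p.Prime)
    (h : ∃ a b : A, a * b ≠ b * a) (N : Subgroup A) [N.Normal] (hN : IsPGroup p N) : N = ⊥ := by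
  have := Fact.mk hp
  refine (IsSimpleGroup.eq_bot_or_eq_top_of_normal N inferInstance).resolve_right ?_
  rintro rfl
  have hA : IsPGroup p A := hN.of_equiv Subgroup.topEquiv
  have := hA.center_nontrivial
  exact (Subgroup.nontrivial_iff_ne_bot _).1 this (IsSimpleGroup.center_eq_bot h)

end SimpleGroup

/-! ### Excluding stabilisers that project onto `T` -/

section Diagonal

variable {p : ℕ} {G Ω : Type*} [Group G] [MulAction G Ω]

/-- Under Property `(*)_p`, if a normal subgroup `A` without nontrivial normal `p`-subgroups meets
the stabiliser of `ω` trivially, then the `p`-elements fixing `ω` centralise `A`. -/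
theorem HasPropertyStar.commute_of_stabilizer_inf_eq_bot [Finite G] (hp : p.Prime)
    (h : HasPropertyStar p G Ω) (A : Subgroup G) [A.Normal]
    (hA : ∀ N : Subgroup A, N.Normal → IsPGroup p N → N = ⊥) (ω : Ω)
    (hω : stabilizer G ω ⊓ A = ⊥) (P : Sylow p G) {x : G} (hx : x ∈ P) (hxω : x • ω = ω)
    {a : A} : (a : G) * x = x * a := by
  have := Fact.mk hp
  have conj_mem : ∀ a ∈ A, a * x * a⁻¹ ∈ P := by
    intro a ha
    -- `E` embeds in `G ⧸ A` with image in that of `P`, so it is a `p`-group. It contains `Q_ω` for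
    -- each conjugate `Q` of `P` by an element of `A`. As `Q_ω` is Sylow in `G_ω`, it equals `E`,
    -- and hence `x` lies in every such `Q`.
    let E : Subgroup G := stabilizer G ω ⊓ (A ⊔ P)
    have hE : IsPGroup p E := by
      let f : E →* G ⧸ A := (QuotientGroup.mk' A).comp E.subtype
      have hf : Function.Injective f := by
        rw [injective_iff_map_eq_one]
        intro y hy
        have h1 : (y : G) ∈ A := (QuotientGroup.eq_one_iff _).1 hy
        have h2 : (y : G) ∈ stabilizer G ω ⊓ A := ⟨y.2.1, h1⟩
        rw [hω] at h2
        exact Subtype.ext h2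
      have h3 : ∀ y, f y ∈ (P : Subgroup G).map (QuotientGroup.mk' A) := by
        intro y
        have h4 : ((A ⊔ P : Subgroup G)).map (QuotientGroup.mk' A) ≤
            (P : Subgroup G).map (QuotientGroup.mk' A) := by
          rw [Subgroup.map_sup, QuotientGroup.map_mk'_self, bot_sup_eq]
        exact h4 ⟨y, y.2.2, rfl⟩
      exact (P.isPGroup'.map _).of_injective (f.codRestrict _ h3)
        fun _ _ hyz => hf (congrArg Subtype.val hyz)
    let Q : Sylow p G := a⁻¹ • P
    obtain ⟨R, hR⟩ := h Q ω
    have hQ : ∀ y, y ∈ Q ↔ a * y * a⁻¹ ∈ P := by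
      intro y
      change y ∈ ((a⁻¹ • P : Sylow p G) : Subgroup G) ↔ _
      rw [Sylow.coe_subgroup_smul, Subgroup.mem_pointwise_smul_iff_inv_smul_mem]
      simp [MulAut.smul_def]
      rfl
    have hle : (R : Subgroup (stabilizer G ω)) ≤ E.subgroupOf (stabilizer G ω) := by
      rw [hR]
      intro y hy
      rw [Subgroup.mem_subgroupOf] at hy ⊢
      refine ⟨y.2, ?_⟩
      have h1 := (hQ _).1 hy
      have h2 : (y : G) = a⁻¹ * (a * y * a⁻¹) * a := by group
      rw [h2]
      have ha' : a ∈ A ⊔ (P : Subgroup G) := Subgroup.mem_sup_left ha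
      have h3 : a * y * a⁻¹ ∈ A ⊔ (P : Subgroup G) := Subgroup.mem_sup_right h1
      exact Subgroup.mul_mem _ (Subgroup.mul_mem _ (Subgroup.inv_mem _ ha') h3) ha'
    have heq := R.is_maximal' (hE.comap_subtype (K := stabilizer G ω)) hle
    have hxE : (⟨x, hxω⟩ : stabilizer G ω) ∈ E.comap (stabilizer G ω).subtype :=
      Subgroup.mem_subgroupOf.2 ⟨hxω, Subgroup.mem_sup_right hx⟩
    rw [heq, hR] at hxE
    exact (hQ x).1 hxE
  -- The commutators of `x` with `A` lie in `P`, and they generate a normal subgroup of `A` because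
  -- conjugating `c a` by `b` gives `c (b * a) * (c b)⁻¹`. This normal `p`-subgroup is trivial.
  let c : A → A := fun a => ⟨a * x * (a : G)⁻¹ * x⁻¹, by
    rw [mul_assoc, mul_assoc, ← mul_assoc x]
    exact mul_mem a.2 (Subgroup.Normal.conj_mem ‹_› _ (inv_mem a.2) x)⟩
  let W : Subgroup A := Subgroup.closure (Set.range c)
  have hWn : W.Normal := by
    rw [← Subgroup.normalizer_eq_top_iff, eq_top_iff, Subgroup.le_normalizer_closure_iff]
    rintro b - _ ⟨a, rfl⟩
    have : b * c a * b⁻¹ = c (b * a) * (c b)⁻¹ := by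
      apply Subtype.ext
      simp only [c, Subgroup.coe_mul, Subgroup.coe_inv]
      group
    rw [this]
    exact mul_mem (Subgroup.subset_closure ⟨_, rfl⟩) (inv_mem (Subgroup.subset_closure ⟨_, rfl⟩))
  have hWp : IsPGroup p W := by
    refine (P.isPGroup'.comap_subtype (K := A)).to_le ?_
    rw [Subgroup.closure_le]
    rintro _ ⟨a, rfl⟩
    exact mul_mem (conj_mem a a.2) (inv_mem hx)
  have h1 : c a ∈ W := Subgroup.subset_closure ⟨a, rfl⟩
  rw [hA W hWn hWp, Subgroup.mem_bot] at h1
  have h2 : (a : G) * x * (a : G)⁻¹ * x⁻¹ = 1 := congrArg Subtype.val h1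
  rw [mul_inv_eq_one, mul_inv_eq_iff_eq_mul] at h2
  exact h2

/-- The elements of `T` acting on `T` by conjugation as some element of `S` does. -/
def conjAgree (S T : Subgroup G) : Subgroup G where
  carrier := {t | t ∈ T ∧ ∃ d ∈ S, ∀ s ∈ T, d * s * d⁻¹ = t * s * t⁻¹}
  one_mem' := ⟨T.one_mem, 1, S.one_mem, fun _ _ => rfl⟩
  mul_mem' := by
    rintro t u ⟨ht, d, hd, hdt⟩ ⟨hu, e, he, heu⟩
    refine ⟨mul_mem ht hu, d * e, mul_mem hd he, fun s hs => ?_⟩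
    have h1 := hdt (u * s * u⁻¹) (mul_mem (mul_mem hu hs) (inv_mem hu))
    rw [← heu s hs] at h1
    rw [show d * e * s * (d * e)⁻¹ = d * (e * s * e⁻¹) * d⁻¹ by group, h1, heu s hs]
    group
  inv_mem' := by
    rintro t ⟨ht, d, hd, hdt⟩
    refine ⟨inv_mem ht, d⁻¹, inv_mem hd, fun s hs => ?_⟩
    have h1 := hdt (t⁻¹ * s * t) (mul_mem (mul_mem (inv_mem ht) hs) ht)
    rw [show t * (t⁻¹ * s * t) * t⁻¹ = s by group] at h1
    nth_rw 1 [← h1]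
    group

/-- Under Property `(*)_p`, the stabiliser of a point does not induce all inner automorphisms on a
nonabelian simple subgroup with order divisible by `p` and transitive normaliser. -/
theorem HasPropertyStar.not_le_conjAgree [Finite G] (hp : p.Prime) {T : Subgroup G}
    (h : HasPropertyStar p (Subgroup.normalizer (T : Set G)) Ω) [IsSimpleGroup T]
    (hT : ∃ a b : T, a * b ≠ b * a) (hpT : p ∣ Nat.card T) (ω : Ω)
    (hω : ¬ T ≤ stabilizer G ω) : ¬ T ≤ conjAgree (stabilizer G ω) T := by
  intro hle
  have := Fact.mk hp
  -- Each element of `T` acts on `T` as an element of the stabiliser does, so it normalises the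
  -- intersection; simplicity leaves only the trivial group.
  have hbot : stabilizer G ω ⊓ T = ⊥ := by
    have hn : ((stabilizer G ω).subgroupOf T).Normal := by
      refine ⟨fun s hs t => ?_⟩
      obtain ⟨-, d, hd, hdt⟩ := hle t.2
      rw [Subgroup.mem_subgroupOf] at hs ⊢
      have := hdt s s.2
      change (t * s * (t : G)⁻¹) ∈ _
      rw [← this]
      exact mul_mem (mul_mem hd hs) (inv_mem hd)
    rcases IsSimpleGroup.eq_bot_or_eq_top_of_normal _ hn with h1 | h1
    · rwa [Subgroup.subgroupOf_eq_bot, disjoint_iff] at h1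
    · exact absurd (Subgroup.subgroupOf_eq_top.1 h1) hω
  let X := Subgroup.normalizer (T : Set G)
  let A : Subgroup X := T.subgroupOf X
  have : A.Normal := Subgroup.normal_in_normalizer
  let eA : A ≃* T := Subgroup.subgroupOfEquivOfLe Subgroup.le_normalizer
  have hA : ∀ N : Subgroup A, N.Normal → IsPGroup p N → N = ⊥ := by
    intro N hN hNp
    have h1 : (N.map eA.toMonoidHom).Normal := hN.map _ eA.surjective
    have h2 := IsSimpleGroup.eq_bot_of_normal_of_isPGroup hp hT (N.map eA.toMonoidHom) (hNp.map _)
    rwa [Subgroup.map_eq_bot_iff_of_injective _ eA.injective] at h2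
  have hAω : stabilizer X ω ⊓ A = ⊥ := by
    rw [eq_bot_iff]
    rintro x ⟨hx, hxA⟩
    have : (x : G) ∈ stabilizer G ω ⊓ T := ⟨hx, hxA⟩
    rw [hbot] at this
    exact Subtype.ext this
  obtain ⟨P⟩ : Nonempty (Sylow p X) := inferInstance
  let c : stabilizer X ω →* MulAut T := T.normalizerMonoidHom.comp (stabilizer X ω).subtype
  have hker : (P : Subgroup X).subgroupOf (stabilizer X ω) ≤ c.ker := by
    intro x hx
    rw [MonoidHom.mem_ker]
    ext t
    have h1 := h.commute_of_stabilizer_inf_eq_bot hp A hA ω hAω P hx x.2 (a := eA.symm t)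
    have h2 : (t : G) * x = x * t := congrArg Subtype.val h1
    change (x : G) * t * (x : G)⁻¹ = t
    rw [← h2]; group
  have hrange : (MulAut.conj : T →* MulAut T).range ≤ c.range := by
    rintro _ ⟨t, rfl⟩
    obtain ⟨-, d, hd, hdt⟩ := hle t.2
    have hdX : d ∈ X := by
      rw [Subgroup.mem_normalizer_iff]
      intro s
      refine ⟨fun hs => by rw [hdt s hs]; exact mul_mem (mul_mem t.2 hs) (inv_mem t.2), fun hs => ?_⟩
      have h1 := hdt _ (mul_mem (mul_mem (inv_mem t.2) hs) t.2)
      have h2 : (t : G) * ((t : G)⁻¹ * (d * s * d⁻¹) * t) * (t : G)⁻¹ = d * s * d⁻¹ := by group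
      rw [h2] at h1
      have h3 := mul_left_cancel (mul_right_cancel h1)
      rw [← h3]
      exact mul_mem (mul_mem (inv_mem t.2) hs) t.2
    refine ⟨⟨⟨d, hdX⟩, hd⟩, ?_⟩
    ext s
    exact hdt s s.2
  -- The image of `c` contains all inner automorphisms of `T`, so `p` divides the index of its
  -- kernel. That kernel contains `P_ω`, contradicting that `P_ω` is Sylow in `X_ω`.
  have h1 : p ∣ Nat.card c.range := by
    refine hpT.trans ?_
    rw [Nat.card_congr (MonoidHom.ofInjective (IsSimpleGroup.conj_injective hT)).toEquiv]
    exact Subgroup.card_dvd_of_le hrange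
  rw [← Subgroup.index_ker] at h1
  exact (hasPropertyStar_iff_not_dvd_relIndex hp).1 h P ω
    (h1.trans (Subgroup.index_dvd_of_le hker))

end Diagonal

/-! ### Products of commuting conjugates of `T` -/

section Conjugates

variable {G : Type*} [Group G]

/-- The conjugate `g T g⁻¹`. -/
def conjSubgroup (g : G) (T : Subgroup G) : Subgroup G := T.map (MulAut.conj g).toMonoidHom

theorem mem_conjSubgroup {g x : G} {T : Subgroup G} : x ∈ conjSubgroup g T ↔ g⁻¹ * x * g ∈ T := by
  constructor
  · rintro ⟨y, hy, rfl⟩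
    change g⁻¹ * (g * y * g⁻¹) * g ∈ T
    rwa [show g⁻¹ * (g * y * g⁻¹) * g = y by group]
  · exact fun h => ⟨_, h, by simp [mul_assoc]⟩

theorem conj_mem_conjSubgroup {g x : G} {T : Subgroup G} (hx : x ∈ T) :
    g * x * g⁻¹ ∈ conjSubgroup g T := ⟨x, hx, rfl⟩

theorem conjSubgroup_eq_of_mem_normalizer {g : G} {T : Subgroup G}
    (hg : g ∈ Subgroup.normalizer (T : Set G)) : conjSubgroup g T = T :=
  Subgroup.mem_normalizer_iff_map_conj_eq.1 hg

theorem conjSubgroup_mul (g h : G) (T : Subgroup G) :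
    conjSubgroup (g * h) T = conjSubgroup g (conjSubgroup h T) := by
  ext x
  simp only [mem_conjSubgroup, mul_inv_rev, mul_assoc]

theorem conj_mem_centralizer_conjSubgroup {g x : G} {T : Subgroup G} :
    g⁻¹ * x * g ∈ Subgroup.centralizer (T : Set G) ↔
      x ∈ Subgroup.centralizer (conjSubgroup g T : Set G) := by
  simp only [Subgroup.mem_centralizer_iff]
  constructor
  · intro h y hy
    have h1 := h _ (mem_conjSubgroup.1 hy)
    have h2 : g * (g⁻¹ * y * g * (g⁻¹ * x * g)) * g⁻¹ =
      g * (g⁻¹ * x * g * (g⁻¹ * y * g)) * g⁻¹ := by rw [h1]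
    simpa [mul_assoc] using h2
  · intro h y hy
    have h1 := h _ (conj_mem_conjSubgroup (g := g) hy)
    have h2 : g⁻¹ * (g * y * g⁻¹ * x) * g = g⁻¹ * (x * (g * y * g⁻¹)) * g := by rw [h1]
    simpa [mul_assoc] using h2

/-- Distinct conjugates of `T` commute elementwise. -/
def ConjugatesCommute (T : Subgroup G) : Prop :=
  ∀ g ∉ Subgroup.normalizer (T : Set G), ∀ x ∈ T, ∀ y ∈ T, Commute x (g * y * g⁻¹)

variable {T : Subgroup G}

theorem ConjugatesCommute.conjSubgroup_le_centralizer (hT : ConjugatesCommute T) {g : G}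
    (hg : g ∉ Subgroup.normalizer (T : Set G)) :
    conjSubgroup g T ≤ Subgroup.centralizer (T : Set G) := by
  rintro _ ⟨y, hy, rfl⟩
  rw [Subgroup.mem_centralizer_iff]
  exact fun x hx => hT g hg x hx y hy

theorem ConjugatesCommute.normalClosure_le_normalizer (hT : ConjugatesCommute T) :
    Subgroup.normalClosure (T : Set G) ≤ Subgroup.normalizer (T : Set G) := by
  rw [Subgroup.normalClosure, Subgroup.closure_le]
  intro x hx
  obtain ⟨t, ht, hc⟩ := Group.mem_conjugatesOfSet_iff.1 hx
  obtain ⟨g, rfl⟩ := isConj_iff.1 hc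
  by_cases hg : g ∈ Subgroup.normalizer (T : Set G)
  · exact Subgroup.le_normalizer ((Subgroup.mem_normalizer_iff.1 hg t).1 ht)
  · exact Subgroup.centralizer_le_normalizer _
      (hT.conjSubgroup_le_centralizer hg (conj_mem_conjSubgroup ht))

/-- The conjugate of `T` indexed by a coset of its normaliser. -/
noncomputable def cosetConjugate (T : Subgroup G) (q : G ⧸ Subgroup.normalizer (T : Set G)) :
    Subgroup G := conjSubgroup q.out T

theorem iSup_cosetConjugate (T : Subgroup G) :
    ⨆ q, cosetConjugate T q = Subgroup.normalClosure (T : Set G) := by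
  apply le_antisymm
  · refine iSup_le fun q => ?_
    rintro _ ⟨t, ht, rfl⟩
    exact Subgroup.normalClosure_normal.conj_mem _ (Subgroup.subset_normalClosure ht) _
  · rw [Subgroup.normalClosure, Subgroup.closure_le]
    intro x hx
    obtain ⟨t, ht, hc⟩ := Group.mem_conjugatesOfSet_iff.1 hx
    obtain ⟨g, rfl⟩ := isConj_iff.1 hc
    refine Subgroup.mem_iSup_of_mem (QuotientGroup.mk g) ?_
    obtain ⟨n, hn⟩ := QuotientGroup.mk_out_eq_mul (Subgroup.normalizer (T : Set G)) g
    rw [cosetConjugate, hn, conjSubgroup_mul, conjSubgroup_eq_of_mem_normalizer n.2]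
    exact conj_mem_conjSubgroup ht

theorem ConjugatesCommute.pairwise (hT : ConjugatesCommute T) :
    Pairwise fun q q' => ∀ x y : G, x ∈ cosetConjugate T q → y ∈ cosetConjugate T q' →
      Commute x y := by
  rintro q q' hq _ _ ⟨x, hx, rfl⟩ ⟨y, hy, rfl⟩
  have hg : q.out⁻¹ * q'.out ∉ Subgroup.normalizer (T : Set G) := by
    rw [← QuotientGroup.eq, QuotientGroup.out_eq', QuotientGroup.out_eq']
    exact hq
  have h1 := hT _ hg x hx y hy
  have h2 : q.out * (x * (q.out⁻¹ * q'.out * y * (q.out⁻¹ * q'.out)⁻¹)) * q.out⁻¹ =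
    q.out * ((q.out⁻¹ * q'.out * y * (q.out⁻¹ * q'.out)⁻¹) * x) * q.out⁻¹ := by rw [h1.eq]
  change q.out * x * q.out⁻¹ * (q'.out * y * q'.out⁻¹) = q'.out * y * q'.out⁻¹ * (q.out * x * q.out⁻¹)
  simpa [mul_assoc] using h2

theorem exists_mem_centralizer_noncommPiCoprod_eq {ι : Type*} [Fintype ι] {H : ι → Subgroup G}
    (hcomm : Pairwise fun i j => ∀ x y : G, x ∈ H i → y ∈ H j → Commute x y) (f : ∀ i, H i)
    (i : ι) : ∃ b ∈ Subgroup.centralizer (H i : Set G),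
      Subgroup.noncommPiCoprod hcomm f = f i * b := by
  classical
  refine ⟨Subgroup.noncommPiCoprod hcomm (Function.update f i 1), ?_, ?_⟩
  · rw [Subgroup.noncommPiCoprod_apply]
    refine Subgroup.noncommProd_mem _ _ fun j _ => ?_
    by_cases h : j = i
    · subst h; simp
    · rw [Subgroup.mem_centralizer_iff]
      intro x hx
      exact hcomm (Ne.symm h) x _ hx (Function.update f i 1 j).2
  · have h1 : f = Pi.mulSingle i (f i) * Function.update f i 1 := by
      ext j
      by_cases h : j = i
      · subst h; simp
      · simp [h]
    conv_lhs => rw [h1]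
    rw [map_mul, Subgroup.noncommPiCoprod_mulSingle]

variable [Finite G]

/-- Every family of elements of the conjugates of `T` has a product. -/
theorem ConjugatesCommute.exists_prod (hT : ConjugatesCommute T)
    (f : ∀ q, cosetConjugate T q) :
    ∃ m ∈ Subgroup.normalClosure (T : Set G),
      ∀ q, ∃ b ∈ Subgroup.centralizer (cosetConjugate T q : Set G), m = f q * b := by
  have := Fintype.ofFinite (G ⧸ Subgroup.normalizer (T : Set G))
  refine ⟨Subgroup.noncommPiCoprod hT.pairwise f, ?_,
    exists_mem_centralizer_noncommPiCoprod_eq hT.pairwise f⟩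
  rw [← iSup_cosetConjugate, ← Subgroup.noncommPiCoprod_range (hcomm := hT.pairwise)]
  exact ⟨f, rfl⟩

/-- The last clause records that `m` is the product of its components: it will put `m` in a point
stabiliser once every component is there. -/
theorem ConjugatesCommute.exists_decomposition (hT : ConjugatesCommute T) {m : G}
    (hm : m ∈ Subgroup.normalClosure (T : Set G)) :
    ∃ f : ∀ q, cosetConjugate T q,
      (∀ q, ∃ b ∈ Subgroup.centralizer (cosetConjugate T q : Set G), m = f q * b) ∧
      ∀ S : Subgroup G, (∀ q, (f q : G) ∈ S) → m ∈ S := by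
  have := Fintype.ofFinite (G ⧸ Subgroup.normalizer (T : Set G))
  rw [← iSup_cosetConjugate, ← Subgroup.noncommPiCoprod_range (hcomm := hT.pairwise)] at hm
  obtain ⟨f, rfl⟩ := hm
  refine ⟨f, exists_mem_centralizer_noncommPiCoprod_eq hT.pairwise f, fun S hS => ?_⟩
  rw [Subgroup.noncommPiCoprod_apply]
  exact Subgroup.noncommProd_mem _ _ fun q _ => hS q

theorem ConjugatesCommute.card_normalClosure_dvd (hT : ConjugatesCommute T) :
    Nat.card (Subgroup.normalClosure (T : Set G)) ∣
      Nat.card T ^ Nat.card (G ⧸ Subgroup.normalizer (T : Set G)) := by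
  have := Fintype.ofFinite (G ⧸ Subgroup.normalizer (T : Set G))
  rw [← iSup_cosetConjugate, ← Subgroup.noncommPiCoprod_range (hcomm := hT.pairwise)]
  refine (Subgroup.card_range_dvd _).trans ?_
  rw [Nat.card_pi]
  have : ∀ q, Nat.card (cosetConjugate T q) = Nat.card T := fun q =>
    (Nat.card_congr (T.equivMapOfInjective _ (MulAut.conj q.out).injective).toEquiv).symm
  simp [this]

end Conjugates

/-! ### Projections of a maximal subgroup to the conjugates of `T` -/

section Stabilizer

variable {G Ω : Type*} [Group G] [MulAction G Ω] {T : Subgroup G}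

theorem conj_mem_conjAgree {S T : Subgroup G} {d y : G} (hd : d ∈ S) (hy : y ∈ conjAgree S T) :
    d * y * d⁻¹ ∈ conjAgree S (conjSubgroup d T) := by
  obtain ⟨hyT, e, he, hey⟩ := hy
  refine ⟨conj_mem_conjSubgroup hyT, d * e * d⁻¹, mul_mem (mul_mem hd he) (inv_mem hd), ?_⟩
  rintro _ ⟨s, hs, rfl⟩
  have h1 : d * (e * s * e⁻¹) * d⁻¹ = d * (y * s * y⁻¹) * d⁻¹ := by rw [hey s hs]
  change d * e * d⁻¹ * (d * s * d⁻¹) * (d * e * d⁻¹)⁻¹ = d * y * d⁻¹ * (d * s * d⁻¹) * (d * y * d⁻¹)⁻¹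
  simpa [mul_assoc] using h1

theorem mem_conjAgree_of_mul_eq {S T : Subgroup G} {t b d : G} (ht : t ∈ T)
    (hb : b ∈ Subgroup.centralizer (T : Set G)) (hd : d ∈ S) (h : t * b = d) :
    t ∈ conjAgree S T := by
  refine ⟨ht, d, hd, fun s hs => ?_⟩
  have h1 := Subgroup.mem_centralizer_iff.1 hb s hs
  rw [← h, mul_inv_rev, mul_assoc t b s, ← h1]
  group

/-- If the maximal subgroup `S` does not induce all inner automorphisms of `T`, then it contains
all elements of conjugates of `T` acting as one of its elements. -/
theorem ConjugatesCommute.conjAgree_le (hT : ConjugatesCommute T) {S : Subgroup G}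
    (hS : IsCoatom S) (h : ¬ T ≤ conjAgree S T) (g : G) : conjAgree S (conjSubgroup g T) ≤ S := by
  let Z : Set G := {y | ∃ g, y ∈ conjAgree S (conjSubgroup g T)}
  let J := Subgroup.closure Z
  have hJ : S ≤ Subgroup.normalizer (J : Set G) := by
    rw [Subgroup.le_normalizer_closure_iff]
    rintro d hd y ⟨g, hy⟩
    refine Subgroup.subset_closure ⟨d * g, ?_⟩
    rw [conjSubgroup_mul]
    exact conj_mem_conjAgree hd hy
  have hTC : conjAgree S T ≤
      Subgroup.normalizer (Subgroup.centralizer (T : Set G) : Set G) := by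
    rw [Subgroup.le_normalizer_iff]
    intro y hy b hb
    rwa [Subgroup.mem_centralizer_iff.1 hb y hy.1, mul_inv_cancel_right]
  have hJC : J ≤ conjAgree S T ⊔ Subgroup.centralizer (T : Set G) := by
    rw [Subgroup.closure_le]
    rintro y ⟨g, hy⟩
    by_cases hg : g ∈ Subgroup.normalizer (T : Set G)
    · rw [conjSubgroup_eq_of_mem_normalizer hg] at hy
      exact Subgroup.mem_sup_left hy
    · exact Subgroup.mem_sup_right (hT.conjSubgroup_le_centralizer hg hy.1)
  -- `J` is normalised by `S`, so if it were not inside `S`, maximality would give `G = S J`. Modulo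
  -- the centraliser of `T`, `J` contributes only elements of `conjAgree S T`, so all of `T` would
  -- lie in the projection of `S`.
  have hle : J ≤ S := by
    by_contra hJS
    have htop : S ⊔ J = ⊤ := hS.2 _ (left_lt_sup.2 hJS)
    apply h
    intro t ht
    have h1 : t ∈ ((S ⊔ J : Subgroup G) : Set G) := by rw [htop]; trivial
    rw [Subgroup.coe_mul_of_left_le_normalizer_right _ _ hJ] at h1
    obtain ⟨d, hd, j, hj, rfl⟩ := h1
    have h2 : j ∈ ((conjAgree S T ⊔ Subgroup.centralizer (T : Set G) : Subgroup G) : Set G) :=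
      hJC hj
    rw [Subgroup.coe_mul_of_left_le_normalizer_right _ _ hTC] at h2
    obtain ⟨y, hy, b, hb, rfl⟩ := h2
    have hyT : y ∈ T := hy.1
    have h3 : d * (y * b) * y⁻¹ ∈ conjAgree S T := by
      refine mem_conjAgree_of_mul_eq (b := b⁻¹) (mul_mem ht (inv_mem hyT)) (inv_mem hb) hd ?_
      have := Subgroup.mem_centralizer_iff.1 hb y hyT
      rw [this]; group
    simpa using mul_mem h3 hy
  exact fun y hy => hle (Subgroup.subset_closure ⟨g, hy⟩)

end Stabilizer

/-! ### The factor `Δ`: orbits of the centraliser of `T` -/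

section CentralizerOrbits

theorem conj_mem_centralizer {G : Type*} [Group G] {T : Subgroup G} {x b : G}
    (hx : x ∈ Subgroup.normalizer (T : Set G)) (hb : b ∈ Subgroup.centralizer (T : Set G)) :
    x * b * x⁻¹ ∈ Subgroup.centralizer (T : Set G) := by
  nth_rw 1 [← conjSubgroup_eq_of_mem_normalizer hx]
  rw [← conj_mem_centralizer_conjSubgroup]
  rwa [show x⁻¹ * (x * b * x⁻¹) * x = b by group]

variable {G : Type*} [Group G]

/-- The orbits of the centraliser of `T` on `Ω`. -/
def CentralizerOrbits (T : Subgroup G) (Ω : Type*) [MulAction G Ω] : Type _ :=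
  orbitRel.Quotient (Subgroup.centralizer (T : Set G)) Ω

variable {Ω : Type*} [MulAction G Ω] {T : Subgroup G}

namespace CentralizerOrbits

/-- The orbit of a point under the centraliser of `T`. -/
def mk (T : Subgroup G) (ω : Ω) : CentralizerOrbits T Ω := Quotient.mk'' ω

theorem mk_surjective : Function.Surjective (mk T : Ω → CentralizerOrbits T Ω) :=
  Quotient.mk''_surjective

theorem mk_eq_mk {ω ω' : Ω} :
    mk T ω = mk T ω' ↔ ∃ b ∈ Subgroup.centralizer (T : Set G), b • ω' = ω := by
  exact Quotient.eq''.trans ⟨fun ⟨b, hb⟩ => ⟨b, b.2, hb⟩, fun ⟨b, hb, h⟩ => ⟨⟨b, hb⟩, h⟩⟩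

instance : MulAction (Subgroup.normalizer (T : Set G)) (CentralizerOrbits T Ω) where
  smul x := Quotient.map' (x • ·) (by
    rintro _ ω ⟨b, rfl⟩
    refine ⟨⟨x * b * (x : G)⁻¹, ?_⟩, ?_⟩
    · exact conj_mem_centralizer x.2 b.2
    · change ((x : G) * (b : G) * (x : G)⁻¹) • (x : G) • ω = (x : G) • (b : G) • ω
      simp [mul_smul])
  one_smul := by
    rintro ⟨ω⟩
    exact congrArg (mk T) (one_smul _ ω)
  mul_smul x y := by
    rintro ⟨ω⟩
    exact congrArg (mk T) (mul_smul x y ω)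

theorem smul_mk (x : Subgroup.normalizer (T : Set G)) (ω : Ω) :
    x • mk T ω = mk T ((x : G) • ω) := rfl

instance [Finite Ω] : Finite (CentralizerOrbits T Ω) := Finite.of_surjective _ mk_surjective

theorem smul_eq_of_mem_centralizer {x : Subgroup.normalizer (T : Set G)}
    (hx : (x : G) ∈ Subgroup.centralizer (T : Set G)) (δ : CentralizerOrbits T Ω) : x • δ = δ := by
  obtain ⟨ω, rfl⟩ := mk_surjective δ
  rw [smul_mk, mk_eq_mk]
  exact ⟨x, hx, rfl⟩

theorem mem_conjAgree_of_mk_eq {t : G} {ω : Ω} (ht : t ∈ T) (h : mk T (t • ω) = mk T ω) :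
    t ∈ conjAgree (stabilizer G ω) T := by
  obtain ⟨b, hb, h⟩ := mk_eq_mk.1 h
  have hbt : t * b⁻¹ = b⁻¹ * t := Subgroup.mem_centralizer_iff.1 (inv_mem hb) t ht
  refine mem_conjAgree_of_mul_eq (d := b⁻¹ * t) ht (inv_mem hb) ?_ hbt
  rw [mem_stabilizer_iff, mul_smul, ← h, inv_smul_smul]

/-- The kernel `Z` of the action on `Δ` meets `T` trivially, since otherwise `T` would fix the class
of `ω` and lie in the projection of its stabiliser. As `Z` and `T` normalise each other, they
commute. -/
theorem mem_centralizer_of_forall_smul_eq [IsSimpleGroup T] {ω : Ω}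
    (hω : ¬ T ≤ conjAgree (stabilizer G ω) T) {x : Subgroup.normalizer (T : Set G)}
    (hx : ∀ δ : CentralizerOrbits T Ω, x • δ = δ) : (x : G) ∈ Subgroup.centralizer (T : Set G) := by
  let Z := (toPermHom (Subgroup.normalizer (T : Set G)) (CentralizerOrbits T Ω)).ker
  have hZ : ∀ z, z ∈ Z ↔ ∀ δ : CentralizerOrbits T Ω, z • δ = δ := fun z => by
    rw [MonoidHom.mem_ker, Equiv.Perm.ext_iff]; rfl
  let N : Subgroup T := Z.comap (Subgroup.inclusion Subgroup.le_normalizer)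
  have hN : N = ⊥ := by
    refine (IsSimpleGroup.eq_bot_or_eq_top_of_normal N inferInstance).resolve_right fun h => hω ?_
    intro t ht
    have h1 : (⟨t, ht⟩ : T) ∈ N := h ▸ Subgroup.mem_top _
    exact mem_conjAgree_of_mk_eq ht ((hZ _).1 h1 (mk T ω))
  rw [Subgroup.mem_centralizer_iff]
  intro t ht
  let t' : Subgroup.normalizer (T : Set G) := ⟨t, Subgroup.le_normalizer ht⟩
  have h1 : x * t' * x⁻¹ * t'⁻¹ ∈ Z := by
    rw [mul_assoc, mul_assoc, ← mul_assoc t']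
    exact mul_mem ((hZ x).2 hx) (Subgroup.Normal.conj_mem inferInstance _
      (inv_mem ((hZ x).2 hx)) t')
  have h2 : (x : G) * t * (x : G)⁻¹ * t⁻¹ ∈ T :=
    mul_mem ((Subgroup.mem_normalizer_iff.1 x.2 t).1 ht) (inv_mem ht)
  have h3 : (⟨_, h2⟩ : T) ∈ N := h1
  rw [hN, Subgroup.mem_bot] at h3
  have h4 : (x : G) * t * (x : G)⁻¹ * t⁻¹ = 1 := congrArg Subtype.val h3
  rw [mul_inv_eq_one, mul_inv_eq_iff_eq_mul] at h4
  exact h4.symm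

/-- An element fixing the class of `ω` can be corrected by an element of the centraliser so as to
fix `ω`; the correction acts trivially on the classes. This is what lets Property `(*)_p` descend to
`Δ`. -/
theorem stabilizer_mk_eq_map (f : Subgroup.normalizer (T : Set G) →* Equiv.Perm (CentralizerOrbits T Ω))
    (hf : f = toPermHom _ _) (ω : Ω) :
    stabilizer f.range (mk T ω) =
      (stabilizer (Subgroup.normalizer (T : Set G)) ω).map f.rangeRestrict := by
  subst hf
  ext ⟨_, x, rfl⟩
  constructor
  · intro hx
    have hx : mk T ((x : G) • ω) = mk T ω := hx
    obtain ⟨b, hb, h⟩ := mk_eq_mk.1 hx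
    let b' : Subgroup.normalizer (T : Set G) := ⟨b, Subgroup.centralizer_le_normalizer _ hb⟩
    refine ⟨b'⁻¹ * x, ?_, Subtype.ext ?_⟩
    · change (b⁻¹ * (x : G)) • ω = ω
      rw [mul_smul, ← h, inv_smul_smul]
    · ext δ
      change (b'⁻¹ * x) • δ = x • δ
      rw [mul_smul]
      exact smul_eq_of_mem_centralizer (inv_mem hb) _
  · rintro ⟨y, hy, h⟩
    have h1 : y • mk T ω = x • mk T ω := DFunLike.congr_fun (congrArg Subtype.val h) (mk T ω)
    change x • mk T ω = mk T ω
    rw [← h1]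
    exact congrArg (mk T) hy

/-- The group induced on the centraliser orbits by the normaliser of `T`. -/
def inducedGroup (T : Subgroup G) (Ω : Type*) [MulAction G Ω] :
    Subgroup (Equiv.Perm (CentralizerOrbits T Ω)) :=
  (toPermHom (Subgroup.normalizer (T : Set G)) (CentralizerOrbits T Ω)).range

theorem hasPropertyStar_inducedGroup [Finite G] {p : ℕ} (hp : p.Prime)
    (h : HasPropertyStar p (Subgroup.normalizer (T : Set G)) Ω) :
    HasPropertyStar p (inducedGroup T Ω) (CentralizerOrbits T Ω) :=
  h.of_surjective hp (MonoidHom.rangeRestrict_surjective _) mk_surjective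
    (stabilizer_mk_eq_map _ rfl)

instance [IsPretransitive (Subgroup.normalizer (T : Set G)) Ω] :
    IsPretransitive (Subgroup.normalizer (T : Set G)) (CentralizerOrbits T Ω) where
  exists_smul_eq δ δ' := by
    obtain ⟨ω, rfl⟩ := mk_surjective δ
    obtain ⟨ω', rfl⟩ := mk_surjective δ'
    obtain ⟨x, rfl⟩ := exists_smul_eq (Subgroup.normalizer (T : Set G)) ω ω'
    exact ⟨x, rfl⟩

theorem isPreprimitive_inducedGroup
    (h : IsPreprimitive (Subgroup.normalizer (T : Set G)) (CentralizerOrbits T Ω)) :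
    IsPreprimitive (inducedGroup T Ω) (CentralizerOrbits T Ω) := by
  let f : CentralizerOrbits T Ω →ₑ[(toPermHom (Subgroup.normalizer (T : Set G))
      (CentralizerOrbits T Ω)).rangeRestrict] CentralizerOrbits T Ω :=
    { toFun := id, map_smul' := fun _ _ => rfl }
  exact IsPreprimitive.of_surjective (f := f) Function.surjective_id

end CentralizerOrbits

theorem MonoidHom.exists_injective_range_of_ker_eq {X Y W : Type*} [Group X] [Group Y] [Group W]
    (φ : X →* Y) (ψ : X →* W) (h : φ.ker = ψ.ker) :
    ∃ f : φ.range →* W, Function.Injective f ∧ ψ.range ≤ f.range := by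
  let f₀ : X ⧸ φ.ker →* W := QuotientGroup.lift φ.ker ψ h.le
  have hf₀ : Function.Injective f₀ := by
    rw [injective_iff_map_eq_one]
    intro x
    induction x using QuotientGroup.induction_on with
    | H x => exact fun hx => (QuotientGroup.eq_one_iff x).2 (h ▸ hx)
  refine ⟨f₀.comp (QuotientGroup.quotientKerEquivRange φ).symm.toMonoidHom,
    hf₀.comp (QuotientGroup.quotientKerEquivRange φ).symm.injective, ?_⟩
  rintro _ ⟨x, rfl⟩
  exact ⟨QuotientGroup.quotientKerEquivRange φ x, congrArg f₀ (MulEquiv.symm_apply_apply _ _)⟩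

theorem CentralizerOrbits.isAlmostSimple_inducedGroup {G Ω : Type u} [Group G] [MulAction G Ω]
    {T : Subgroup G} [IsSimpleGroup T] (hT : ∃ a b : T, a * b ≠ b * a) {ω : Ω}
    (hω : ¬ T ≤ conjAgree (stabilizer G ω) T) : IsAlmostSimple (inducedGroup T Ω) := by
  obtain ⟨f, hf, hr⟩ := MonoidHom.exists_injective_range_of_ker_eq
    (toPermHom (Subgroup.normalizer (T : Set G)) (CentralizerOrbits T Ω)) T.normalizerMonoidHom (by
      rw [Subgroup.normalizerMonoidHom_ker]
      ext x
      rw [MonoidHom.mem_ker, Equiv.Perm.ext_iff, Subgroup.mem_subgroupOf]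
      exact ⟨fun h => mem_centralizer_of_forall_smul_eq hω h, smul_eq_of_mem_centralizer⟩)
  refine ⟨T, inferInstance, inferInstance, hT, f, hf, le_trans ?_ hr⟩
  rintro _ ⟨t, rfl⟩
  exact ⟨⟨t, Subgroup.le_normalizer t.2⟩, by ext; rfl⟩

end CentralizerOrbits

/-! ### Identifying `Ω` with a power of `Δ` -/

section Coordinates

variable {G Ω : Type*} [Group G] [MulAction G Ω] {T : Subgroup G}

open CentralizerOrbits

/-- The coordinates of a point, indexed by the conjugates of `T`. -/
noncomputable def coordinates (T : Subgroup G) (ω : Ω) (q : G ⧸ Subgroup.normalizer (T : Set G)) :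
    CentralizerOrbits T Ω := mk T (q.out⁻¹ • ω)

/-- The element of the normaliser of `T` by which `g` acts into the coordinate `q`. -/
noncomputable def coordinateElement (T : Subgroup G) (g : G)
    (q : G ⧸ Subgroup.normalizer (T : Set G)) : Subgroup.normalizer (T : Set G) :=
  ⟨q.out⁻¹ * g * (g⁻¹ • q).out, by
    rw [mul_assoc, ← QuotientGroup.eq, QuotientGroup.out_eq', ← smul_eq_mul,
      ← MulAction.Quotient.smul_mk, QuotientGroup.out_eq', smul_inv_smul]⟩

theorem coordinates_smul (g : G) (ω : Ω) (q : G ⧸ Subgroup.normalizer (T : Set G)) :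
    coordinates T (g • ω) q = coordinateElement T g q • coordinates T ω (g⁻¹ • q) := by
  rw [coordinates, coordinates, smul_mk, coordinateElement, smul_smul]
  simp [mul_smul]

theorem isPreprimitive_centralizerOrbits [Finite Ω] [IsPreprimitive G Ω]
    [IsPretransitive (Subgroup.normalizer (T : Set G)) Ω]
    (hbij : Function.Bijective (coordinates T : Ω → _)) :
    IsPreprimitive (Subgroup.normalizer (T : Set G)) (CentralizerOrbits T Ω) where
  isTrivialBlock_of_isBlock {B} hB := by
    -- A block `B` of `Δ` gives the block of points with all coordinates in `B`; that block is
    -- trivial, and constant families of coordinates transfer this to `B`.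
    let S : Set Ω := {ω | ∀ q, coordinates T ω q ∈ B}
    have hS : IsBlock G S := by
      rw [isBlock_iff_disjoint_smul_of_ne]
      intro g hg
      by_contra hd
      obtain ⟨_, ⟨ω, hω, rfl⟩, hgω⟩ := Set.not_disjoint_iff.1 hd
      apply hg
      have h1 : ∀ q, coordinateElement T g q • B = B := by
        intro q
        by_contra hne
        have := isBlock_iff_disjoint_smul_of_ne.1 hB hne
        have h2 := hgω q
        change coordinates T (g • ω) q ∈ B at h2
        rw [coordinates_smul] at h2
        exact Set.disjoint_left.1 this ⟨_, hω _, rfl⟩ h2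
      refine Set.eq_of_subset_of_ncard_le ?_ (Set.ncard_smul_set g S).ge (Set.toFinite _)
      rintro _ ⟨ω', hω', rfl⟩ q
      change coordinates T (g • ω') q ∈ B
      rw [coordinates_smul, ← h1 q]
      exact ⟨_, hω' _, rfl⟩
    rcases hS.subsingleton_or_eq_univ with h | h
    · left
      intro δ hδ δ' hδ'
      obtain ⟨ω, hω⟩ := hbij.2 fun _ => δ
      obtain ⟨ω', hω'⟩ := hbij.2 fun _ => δ'
      have h1 : ω = ω' := h (fun q => by rw [hω]; exact hδ) (fun q => by rw [hω']; exact hδ')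
      rw [h1, hω'] at hω
      exact (congrFun hω (QuotientGroup.mk 1)).symm
    · right
      refine Set.eq_univ_of_forall fun δ => ?_
      obtain ⟨ω, hω⟩ := hbij.2 fun _ => δ
      have h1 : ω ∈ S := h ▸ Set.mem_univ ω
      have := h1 (QuotientGroup.mk 1)
      rwa [hω] at this

variable [Finite G]

/-- Moving `ω₀` into a prescribed class at `q` needs only the `q`-component of an element of the
normal closure, because the rest centralises that conjugate. The components for different `q` can be
chosen independently and multiplied. -/
theorem ConjugatesCommute.coordinates_surjective [Nonempty Ω] (hT : ConjugatesCommute T)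
    [IsPretransitive (Subgroup.normalClosure (T : Set G)) Ω] :
    Function.Surjective (coordinates T : Ω → _) := by
  intro δ
  let ω₀ : Ω := Classical.arbitrary Ω
  have h1 : ∀ q, ∃ f : cosetConjugate T q, mk T (q.out⁻¹ • (f : G) • ω₀) = δ q := by
    intro q
    obtain ⟨ω, hω⟩ := mk_surjective (δ q)
    obtain ⟨m, hm⟩ := exists_smul_eq (Subgroup.normalClosure (T : Set G)) ω₀ (q.out • ω)
    obtain ⟨f, hf, -⟩ := hT.exists_decomposition m.2
    obtain ⟨b, hb, hmb⟩ := hf q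
    refine ⟨f q, ?_⟩
    rw [← hω, mk_eq_mk]
    refine ⟨q.out⁻¹ * b⁻¹ * q.out,
      conj_mem_centralizer_conjSubgroup.2 (inv_mem hb), ?_⟩
    have hm' : ((f q : G) * b) • ω₀ = q.out • ω := by rw [← hmb]; exact hm
    rw [Subgroup.mem_centralizer_iff.1 hb _ (f q).2] at hm'
    rw [mul_smul, ← hm', smul_smul, smul_smul]
    congr 1
    group
  choose f hf using h1
  obtain ⟨m, -, hm⟩ := hT.exists_prod f
  refine ⟨m • ω₀, funext fun q => ?_⟩
  obtain ⟨b, hb, hmb⟩ := hm q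
  rw [← hf q, coordinates, mk_eq_mk]
  refine ⟨q.out⁻¹ * b * q.out, conj_mem_centralizer_conjSubgroup.2 hb, ?_⟩
  rw [hmb, Subgroup.mem_centralizer_iff.1 hb _ (f q).2]
  simp only [smul_smul]
  congr 1
  group

theorem ConjugatesCommute.coordinates_injective (hT : ConjugatesCommute T)
    [IsPretransitive (Subgroup.normalClosure (T : Set G)) Ω]
    (h : ∀ (ω : Ω) (g : G), conjAgree (stabilizer G ω) (conjSubgroup g T) ≤ stabilizer G ω) :
    Function.Injective (coordinates T : Ω → _) := by
  intro ω' ω hω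
  obtain ⟨m, rfl⟩ := exists_smul_eq (Subgroup.normalClosure (T : Set G)) ω ω'
  obtain ⟨f, hf, hS⟩ := hT.exists_decomposition m.2
  -- It suffices that each component `f q` acts on its conjugate of `T` as some element fixing `ω`.
  -- Equality of the `q`-coordinates yields `n'` centralising that conjugate with `n' • ω = m • ω`,
  -- and `n'⁻¹ * m` is such an element.
  refine hS (stabilizer G ω) fun q => h ω q.out ?_
  obtain ⟨b, hb, hmb⟩ := hf q
  obtain ⟨n, hn, hnω⟩ := mk_eq_mk.1 (congrFun hω q)
  let n' := q.out * n * q.out⁻¹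
  have hn' : n' ∈ Subgroup.centralizer (conjSubgroup q.out T : Set G) := by
    rw [← conj_mem_centralizer_conjSubgroup]
    have : q.out⁻¹ * n' * q.out = n := by simp only [n']; group
    rwa [this]
  have hfq : (f q : G) ∈ conjSubgroup q.out T := (f q).2
  have h1 : n' • ω = (m : G) • ω := by
    have h2 : q.out • n • q.out⁻¹ • ω = q.out • q.out⁻¹ • m • ω := by rw [hnω]
    rw [smul_inv_smul] at h2
    simp only [n', mul_smul]
    exact h2
  refine mem_conjAgree_of_mul_eq (b := n'⁻¹ * b) (d := n'⁻¹ * m) hfq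
    (mul_mem (inv_mem hn') hb) ?_ ?_
  · rw [mem_stabilizer_iff, mul_smul, ← h1, inv_smul_smul]
  · have h2 := Subgroup.mem_centralizer_iff.1 (inv_mem hn') _ hfq
    rw [hmb, ← mul_assoc, h2, mul_assoc]

/-- If `p` divides the order of the group permuting the coordinates, then the number of values of a
coordinate is a power of `p`. -/
theorem ConjugatesCommute.card_centralizerOrbits_eq_pow [Finite Ω] {p : ℕ} (hp : p.Prime)
    (hT : ConjugatesCommute T) [Nonempty Ω]
    [IsPretransitive (Subgroup.normalClosure (T : Set G)) Ω]
    (hstar : HasPropertyStar p G Ω) (hbij : Function.Bijective (coordinates T : Ω → _))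
    (hdvd : p ∣ Nat.card (toPermHom G (G ⧸ Subgroup.normalizer (T : Set G))).range) :
    ∃ a : ℕ, Nat.card (CentralizerOrbits T Ω) = p ^ a := by
  have := Fact.mk hp
  let N := Subgroup.normalClosure (T : Set G)
  obtain ⟨Q⟩ : Nonempty (Sylow p N) := inferInstance
  obtain ⟨P, hQP⟩ := (Q.isPGroup'.map N.subtype).exists_le_sylow
  obtain ⟨g, hgP, hg⟩ : ∃ g ∈ P, toPermHom G (G ⧸ Subgroup.normalizer (T : Set G)) g ≠ 1 := by
    by_contra! h
    rw [← Subgroup.index_ker] at hdvd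
    exact P.not_dvd_index (hdvd.trans (Subgroup.index_dvd_of_le h))
  obtain ⟨q, hq⟩ : ∃ q : G ⧸ Subgroup.normalizer (T : Set G), g⁻¹ • q ≠ q := by
    by_contra! h
    refine hg (Equiv.ext fun q => ?_)
    have := h q
    rw [inv_smul_eq_iff] at this
    exact this.symm
  have hNX : ∀ (m : N) (q : G ⧸ Subgroup.normalizer (T : Set G)), (m : G)⁻¹ • q = q := by
    intro m q
    obtain ⟨x, rfl⟩ := QuotientGroup.mk_surjective q
    rw [MulAction.Quotient.smul_mk, QuotientGroup.eq, smul_eq_mul]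
    apply hT.normalClosure_le_normalizer
    have := Subgroup.normalClosure_normal.conj_mem (m : G) m.2 x⁻¹
    simpa [mul_assoc] using this
  let c : N →* Subgroup.normalizer (T : Set G) :=
    (Subgroup.inclusion hT.normalClosure_le_normalizer).comp
      (MulAut.conjNormal (H := N) q.out⁻¹).toMonoidHom
  have hc : ∀ m : N, coordinateElement T (m : G) q = c m := by
    intro m
    apply Subtype.ext
    change q.out⁻¹ * (m : G) * ((m : G)⁻¹ • q).out = q.out⁻¹ * m * q.out⁻¹⁻¹
    rw [hNX, inv_inv]
  let R : Subgroup (Subgroup.normalizer (T : Set G)) := (Q : Subgroup N).map c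
  let ω₀ : Ω := Classical.arbitrary Ω
  let δ₀ : CentralizerOrbits T Ω := mk T ω₀
  -- Take a point with coordinate `δ` at `q` and `δ₀` elsewhere. Its image under `g` has a
  -- `q`-coordinate independent of `δ`, since `g` brings it from `g⁻¹ • q ≠ q`. Elements of `Q` fix
  -- every index and `Q` has the same orbits as `P`, so `R` links `δ` to that fixed value.
  have hR : orbit R (coordinateElement T g q • δ₀) = Set.univ := by
    refine Set.eq_univ_of_forall fun δ => ?_
    classical
    obtain ⟨ω, hω⟩ := hbij.2 (Function.update (fun _ => δ₀) q δ)
    have h1 : g • ω ∈ orbit Q ω := by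
      rw [← hstar.orbit_eq hp Q P.isPGroup' hQP]
      exact ⟨⟨g, hgP⟩, rfl⟩
    obtain ⟨r, hr⟩ := h1
    have h2 : coordinates T (((r : N) : G) • ω) q = coordinates T (g • ω) q :=
      congrFun (congrArg (coordinates T) hr) q
    rw [coordinates_smul, coordinates_smul, hc, hNX, hω, Function.update_self,
      Function.update_of_ne hq] at h2
    rw [← h2, mem_orbit_symm]
    exact ⟨⟨c r, r, r.2, rfl⟩, rfl⟩
  obtain ⟨a, ha⟩ := ncard_orbit_eq_pow hp (Q.isPGroup'.map c) (coordinateElement T g q • δ₀)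
  refine ⟨a, ?_⟩
  rw [← ha, ← Set.ncard_univ, ← hR]

end Coordinates

/-! ### Minimal normal subgroups and the three cases -/

section Assembly

variable {G Ω : Type*} [Group G] [MulAction G Ω]

theorem isPretransitive_of_normal_of_ne_bot [FaithfulSMul G Ω] [IsPreprimitive G Ω]
    (N : Subgroup G) [N.Normal] (hN : N ≠ ⊥) : IsPretransitive N Ω := by
  refine IsQuasiPreprimitive.isPretransitive_of_normal fun h => hN ?_
  rw [eq_bot_iff]
  intro n hn
  rw [Subgroup.mem_bot]
  refine FaithfulSMul.eq_of_smul_eq_smul (α := Ω) fun ω => ?_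
  have h1 : ω ∈ fixedPoints N Ω := h ▸ Set.mem_univ ω
  rw [one_smul]
  exact h1 ⟨n, hn⟩

theorem ConjugatesCommute.not_le_stabilizer [FaithfulSMul G Ω] {T : Subgroup G}
    (hT : ConjugatesCommute T) [IsPretransitive (Subgroup.normalClosure (T : Set G)) Ω]
    (hne : T ≠ ⊥) (ω : Ω) : ¬ T ≤ stabilizer G ω := by
  intro h
  apply hne
  rw [eq_bot_iff]
  intro t ht
  rw [Subgroup.mem_bot]
  refine FaithfulSMul.eq_of_smul_eq_smul (α := Ω) fun ω' => ?_
  obtain ⟨m, rfl⟩ := exists_smul_eq (Subgroup.normalClosure (T : Set G)) ω ω'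
  have h1 : (m : G)⁻¹ * t * m ∈ T := by
    have := (Subgroup.mem_normalizer_iff.1
      (inv_mem (hT.normalClosure_le_normalizer m.2)) t).1 ht
    simpa using this
  have h2 : ((m : G)⁻¹ * t * m) • ω = ω := h h1
  rw [mul_smul, mul_smul, inv_smul_eq_iff] at h2
  rw [one_smul]
  exact h2

theorem ConjugatesCommute.prime_dvd_card [Finite G] [Finite Ω] [Nonempty Ω] {p : ℕ} (hp : p.Prime)
    {T : Subgroup G} (hT : ConjugatesCommute T)
    [IsPretransitive (Subgroup.normalClosure (T : Set G)) Ω] (h : p ∣ Nat.card Ω) :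
    p ∣ Nat.card T := by
  refine hp.dvd_of_dvd_pow ((h.trans ?_).trans hT.card_normalClosure_dvd)
  rw [← index_stabilizer_of_transitive (Subgroup.normalClosure (T : Set G))
    (Classical.arbitrary Ω)]
  exact Subgroup.index_dvd_card _

/-- A nonabelian minimal normal subgroup is generated by pairwise commuting conjugates of a
nonabelian simple subgroup. -/
theorem exists_isSimpleGroup_of_minimal_normal [Finite G] (M : Subgroup G) [M.Normal]
    (hM : M ≠ ⊥) (hmin : ∀ N : Subgroup G, N.Normal → N ≤ M → N ≠ ⊥ → N = M)
    (hab : ¬ ∀ a b : M, a * b = b * a) :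
    ∃ T : Subgroup G, ConjugatesCommute T ∧ IsSimpleGroup T ∧ (∃ a b : T, a * b ≠ b * a) ∧
      Subgroup.normalClosure (T : Set G) = M := by
  -- `T` is a minimal normal subgroup of `M`. Conjugates of `T` are again normalised by `M`, so
  -- distinct ones meet trivially and therefore commute.
  obtain ⟨T, ⟨hTM, hT0, hMT⟩, hTmin⟩ := wellFounded_lt.has_min
    {T : Subgroup G | T ≤ M ∧ T ≠ ⊥ ∧ M ≤ Subgroup.normalizer (T : Set G)}
    ⟨M, le_rfl, hM, Subgroup.le_normalizer⟩
  have hcl : Subgroup.normalClosure (T : Set G) = M := by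
    refine hmin _ Subgroup.normalClosure_normal (Subgroup.normalClosure_le_normal hTM) fun h => hT0 ?_
    exact eq_bot_iff.2 (h ▸ Subgroup.subset_normalClosure)
  have hgM : ∀ g, conjSubgroup g T ≤ M := by
    rintro g _ ⟨t, ht, rfl⟩
    exact Subgroup.Normal.conj_mem ‹_› t (hTM ht) g
  have hMg : ∀ g, M ≤ Subgroup.normalizer (conjSubgroup g T : Set G) := by
    intro g
    rw [Subgroup.le_normalizer_iff]
    rintro m hm _ ⟨t, ht, rfl⟩
    rw [mem_conjSubgroup]
    have h1 : g⁻¹ * m * g ∈ M := by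
      simpa using Subgroup.Normal.conj_mem ‹M.Normal› m hm g⁻¹
    have h2 := (Subgroup.mem_normalizer_iff.1 (hMT h1) t).1 ht
    change g⁻¹ * (m * (g * t * g⁻¹) * m⁻¹) * g ∈ T
    simpa [mul_assoc] using h2
  have hcomm : ConjugatesCommute T := by
    intro g hg x hx y hy
    have hy' : g * y * g⁻¹ ∈ conjSubgroup g T := conj_mem_conjSubgroup hy
    have hinf : T ⊓ conjSubgroup g T = ⊥ := by
      by_contra hne
      have h1 : T ⊓ conjSubgroup g T = T := by
        refine eq_of_le_of_not_lt inf_le_left (hTmin _ ⟨inf_le_left.trans hTM, hne, ?_⟩)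
        rw [Subgroup.le_normalizer_iff]
        exact fun m hm k hk => ⟨(Subgroup.mem_normalizer_iff.1 (hMT hm) k).1 hk.1,
          (Subgroup.mem_normalizer_iff.1 (hMg g hm) k).1 hk.2⟩
      apply hg
      rw [Subgroup.mem_normalizer_iff_map_conj_eq]
      symm
      refine Subgroup.eq_of_le_of_card_ge (inf_eq_left.1 h1) (le_of_eq ?_)
      exact (Nat.card_congr (T.equivMapOfInjective _ (MulAut.conj g).injective).toEquiv).symm
    have h2 : x * (g * y * g⁻¹) * x⁻¹ * (g * y * g⁻¹)⁻¹ ∈ T ⊓ conjSubgroup g T := by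
      refine Subgroup.mem_inf.2 ⟨?_, ?_⟩
      · rw [mul_assoc, mul_assoc, ← mul_assoc (g * y * g⁻¹)]
        exact T.mul_mem hx
          ((Subgroup.mem_normalizer_iff.1 (hMT (hgM g hy')) _).1 (T.inv_mem hx))
      · exact mul_mem ((Subgroup.mem_normalizer_iff.1 (hMg g (hTM hx)) _).1 hy') (inv_mem hy')
    rw [hinf, Subgroup.mem_bot, mul_inv_eq_one, mul_inv_eq_iff_eq_mul] at h2
    exact h2
  have hnontriv : Nontrivial T := (Subgroup.nontrivial_iff_ne_bot T).2 hT0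
  refine ⟨T, hcomm, ⟨fun N hN => ?_⟩, ?_, hcl⟩
  -- A normal subgroup of `T` is normalised by `T` and centralised by the other conjugates, hence
  -- normalised by `M`; minimality of `T` applies.
  · by_contra! hne
    have hle : N.map T.subtype ≤ T := Subgroup.map_subtype_le N
    have h1 : N.map T.subtype = T := by
      refine eq_of_le_of_not_lt hle (hTmin _ ⟨hle.trans hTM, ?_, ?_⟩)
      · rw [Ne, Subgroup.map_eq_bot_iff_of_injective _ T.subtype_injective]
        exact hne.1
      · rw [← hcl, Subgroup.normalClosure, Subgroup.closure_le]
        intro x hx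
        obtain ⟨t, ht, hc⟩ := Group.mem_conjugatesOfSet_iff.1 hx
        obtain ⟨g, rfl⟩ := isConj_iff.1 hc
        by_cases hg : g ∈ Subgroup.normalizer (T : Set G)
        · have h2 := (Subgroup.mem_normalizer_iff.1 hg t).1 ht
          have h3 : T ≤ Subgroup.normalizer (N.map T.subtype : Set G) := by
            rw [Subgroup.le_normalizer_iff]
            rintro s hs _ ⟨n, hn, rfl⟩
            exact ⟨⟨s, hs⟩ * n * ⟨s, hs⟩⁻¹, hN.conj_mem n hn _, rfl⟩
          exact h3 h2
        · refine Subgroup.centralizer_le_normalizer _ ?_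
          exact Subgroup.centralizer_le hle
            (hcomm.conjSubgroup_le_centralizer hg (conj_mem_conjSubgroup ht))
    apply hne.2
    rw [eq_top_iff]
    intro t _
    obtain ⟨n, hn, hnt⟩ := h1.ge t.2
    rwa [← Subtype.ext hnt]
  · by_contra! hTab
    have h1 : M ≤ Subgroup.centralizer (T : Set G) := by
      rw [← hcl, Subgroup.normalClosure, Subgroup.closure_le]
      intro x hx
      obtain ⟨t, ht, hc⟩ := Group.mem_conjugatesOfSet_iff.1 hx
      obtain ⟨g, rfl⟩ := isConj_iff.1 hc
      by_cases hg : g ∈ Subgroup.normalizer (T : Set G)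
      · have h2 := (Subgroup.mem_normalizer_iff.1 hg t).1 ht
        exact Subgroup.mem_centralizer_iff.2 fun s hs =>
          congrArg Subtype.val (hTab ⟨s, hs⟩ ⟨_, h2⟩)
      · exact hcomm.conjSubgroup_le_centralizer hg (conj_mem_conjSubgroup ht)
    have h2 : M ≤ Subgroup.centralizer (M : Set G) := by
      nth_rw 1 [← hcl]
      exact Subgroup.normalClosure_le_normal (Subgroup.le_centralizer_iff.1 h1)
    exact hab fun a b => Subtype.ext (Subgroup.mem_centralizer_iff.1 (h2 b.2) a a.2)

/-- A commutative minimal normal subgroup is elementary abelian. -/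
theorem forall_pow_eq_one_of_minimal_normal [Finite G] (M : Subgroup G) [M.Normal]
    (hmin : ∀ N : Subgroup G, N.Normal → N ≤ M → N ≠ ⊥ → N = M)
    (hab : ∀ a b : M, a * b = b * a) {r : ℕ} (hr : r.Prime) (hrM : r ∣ Nat.card M) (a : M) :
    a ^ r = 1 := by
  have := Fact.mk hr
  let N : Subgroup G :=
    { carrier := {x | x ∈ M ∧ x ^ r = 1}
      one_mem' := ⟨M.one_mem, one_pow r⟩
      mul_mem' := by
        rintro x y ⟨hx, hxr⟩ ⟨hy, hyr⟩
        have hc : Commute x y := congrArg Subtype.val (hab ⟨x, hx⟩ ⟨y, hy⟩)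
        exact ⟨mul_mem hx hy, by rw [hc.mul_pow, hxr, hyr, one_mul]⟩
      inv_mem' := by
        rintro x ⟨hx, hxr⟩
        exact ⟨inv_mem hx, by rw [inv_pow, hxr, inv_one]⟩ }
  have hN : N.Normal := ⟨fun x hx g => ⟨Subgroup.Normal.conj_mem ‹_› x hx.1 g, by
    rw [conj_pow, hx.2, mul_one, mul_inv_cancel]⟩⟩
  have hN0 : N ≠ ⊥ := by
    obtain ⟨x, hx⟩ := exists_prime_orderOf_dvd_card' r hrM
    intro h
    have h1 : (x : G) ∈ N := ⟨x.2, by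
      rw [← Subgroup.coe_pow, ← hx, pow_orderOf_eq_one, Subgroup.coe_one]⟩
    rw [h, Subgroup.mem_bot] at h1
    have h2 : x = 1 := Subtype.ext h1
    rw [h2, orderOf_one] at hx
    exact hr.one_lt.ne hx
  have h1 : (a : G) ∈ N := (hmin N hN (fun _ h => h.1) hN0).ge a.2
  exact Subtype.ext h1.2

/-- The centraliser of `T` is normal; were it nontrivial it would be transitive, and each `t • ω`
could be returned to `ω` by the centraliser, placing `T` in the projection of the stabiliser. So `G`
acts faithfully on `T` by conjugation. -/
theorem isAlmostSimple_of_normalizer_eq_top {G : Type u} {Ω : Type*} [Group G] [MulAction G Ω]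
    [FaithfulSMul G Ω] [IsPreprimitive G Ω] {T : Subgroup G} [IsSimpleGroup T]
    (hT : ∃ a b : T, a * b ≠ b * a) (hn : Subgroup.normalizer (T : Set G) = ⊤) {ω : Ω}
    (hω : ¬ T ≤ conjAgree (stabilizer G ω) T) : IsAlmostSimple G := by
  have hTn : T.Normal := Subgroup.normalizer_eq_top_iff.1 hn
  have hC : Subgroup.centralizer (T : Set G) = ⊥ := by
    by_contra hne
    have := isPretransitive_of_normal_of_ne_bot (Ω := Ω) _ hne
    apply hω
    intro t ht
    obtain ⟨b, hb⟩ := exists_smul_eq (Subgroup.centralizer (T : Set G)) ω (t • ω)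
    exact CentralizerOrbits.mem_conjAgree_of_mk_eq ht (CentralizerOrbits.mk_eq_mk.2 ⟨b, b.2, hb⟩)
  refine ⟨T, inferInstance, inferInstance, hT, MulAut.conjNormal, ?_, ?_⟩
  · rw [injective_iff_map_eq_one]
    intro g hg
    rw [← Subgroup.mem_bot, ← hC, Subgroup.mem_centralizer_iff]
    intro t ht
    have h1 : g * t * g⁻¹ = t := congrArg Subtype.val (DFunLike.congr_fun hg (⟨t, ht⟩ : T))
    rw [mul_inv_eq_iff_eq_mul] at h1
    exact h1.symm
  · rintro _ ⟨t, rfl⟩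
    exact ⟨t, by ext; rfl⟩

theorem ConjugatesCommute.isStarProductType {Ω : Type u} [Finite Ω] [Nontrivial Ω]
    {G : Subgroup (Equiv.Perm Ω)} [IsPreprimitive G Ω] {p : ℕ} (hp : p.Prime)
    (hstar : HasPropertyStar p G Ω) {T : Subgroup G} (hT : ConjugatesCommute T) [IsSimpleGroup T]
    (hab : ∃ a b : T, a * b ≠ b * a)
    [IsPretransitive (Subgroup.normalClosure (T : Set G)) Ω]
    (hn : Subgroup.normalizer (T : Set G) ≠ ⊤)
    (hω : ∀ ω : Ω, ¬ T ≤ conjAgree (stabilizer G ω) T) : IsStarProductType p G := by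
  let X := Subgroup.normalizer (T : Set G)
  have hX : IsPretransitive X Ω := IsPretransitive.of_smul_eq
    (Subgroup.inclusion hT.normalClosure_le_normalizer) rfl
  have hbij : Function.Bijective (coordinates T : Ω → _) :=
    ⟨hT.coordinates_injective fun ω g =>
      hT.conjAgree_le (IsPreprimitive.isCoatom_stabilizer_of_isPreprimitive G ω) (hω ω) g,
      hT.coordinates_surjective⟩
  let κ : Fin (Nat.card (G ⧸ X)) ≃ G ⧸ X := (Finite.equivFin _).symm
  let e : Ω ≃ (Fin (Nat.card (G ⧸ X)) → CentralizerOrbits T Ω) :=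
    (Equiv.ofBijective _ hbij).trans (Equiv.arrowCongr κ.symm (Equiv.refl _))
  let ρ : G →* Equiv.Perm (Fin (Nat.card (G ⧸ X))) :=
    κ.symm.permCongrHom.toMonoidHom.comp (toPermHom G (G ⧸ X))
  have hρ : Nat.card ρ.range = Nat.card (toPermHom G (G ⧸ X)).range := by
    rw [MonoidHom.range_comp]
    exact (Nat.card_congr (Subgroup.equivMapOfInjective _ _
      κ.symm.permCongrHom.injective).toEquiv).symm
  refine ⟨Nat.card (G ⧸ X), CentralizerOrbits T Ω, inferInstance, e,
    CentralizerOrbits.inducedGroup T Ω, ρ.range, ?_, fun g hg => ?_,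
    CentralizerOrbits.isAlmostSimple_inducedGroup hab (hω (Classical.arbitrary Ω)),
    CentralizerOrbits.isPreprimitive_inducedGroup (isPreprimitive_centralizerOrbits hbij),
    CentralizerOrbits.hasPropertyStar_inducedGroup hp (hstar.subgroup hp X), ?_⟩
  · change 2 ≤ X.index
    have h0 : X.index ≠ 0 := Subgroup.index_ne_zero_of_finite
    have h1 : X.index ≠ 1 := fun h => hn (Subgroup.index_eq_one.1 h)
    omega
  · let g' : G := ⟨g, hg⟩
    refine ⟨fun i => toPermHom X (CentralizerOrbits T Ω) (coordinateElement T g' (κ i)), ρ g',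
      fun i => ⟨_, rfl⟩, ⟨g', rfl⟩, ?_⟩
    refine Equiv.ext fun x => funext fun i => ?_
    obtain ⟨ω, rfl⟩ := e.surjective x
    have h1 : κ ((ρ g')⁻¹ i) = g'⁻¹ • κ i := by
      rw [← map_inv]
      change κ (κ.symm (g'⁻¹ • κ i)) = _
      rw [Equiv.apply_symm_apply]
    change e (g (e.symm (e ω))) i = coordinateElement T g' (κ i) •
      coordinates T ω (κ ((ρ g')⁻¹ i))
    rw [h1, e.symm_apply_apply]
    exact coordinates_smul g' ω (κ i)
  · rw [hρ]
    by_cases h : p ∣ Nat.card (toPermHom G (G ⧸ X)).range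
    swap
    · exact Or.inl ((Nat.Prime.coprime_iff_not_dvd hp).2 h)
    · exact Or.inr ⟨h, hT.card_centralizerOrbits_eq_pow hp hstar hbij h⟩

end Assembly

theorem theorem2 {Ω : Type u} [Finite Ω] [Nonempty Ω] (G : Subgroup (Equiv.Perm Ω))
    (hG : MulAction.IsPreprimitive G Ω) (p : ℕ) (hp : p.Prime) :
    (p ∣ Nat.card Ω → HasPropertyStar p G Ω →
      IsAlmostSimple G ∨
      (IsAffineType G ∧ ∃ k : ℕ, Nat.card Ω = p ^ k) ∨
      IsStarProductType p G) ∧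
    ((IsAffineType G ∧ ∃ k : ℕ, Nat.card Ω = p ^ k) → HasPropertyStar p G Ω) ∧
    (IsStarProductType p G → HasPropertyStar p G Ω) := by
  refine ⟨fun hpΩ hstar => ?_, fun ⟨_, k, hk⟩ => hasPropertyStar_of_card_eq_pow hp hk,
    fun h => h.hasPropertyStar hp⟩
  have : Nontrivial Ω := Finite.one_lt_card_iff_nontrivial.1
    (hp.one_lt.trans_le (Nat.le_of_dvd Nat.card_pos hpΩ))
  have hG0 : (⊤ : Subgroup G) ≠ ⊥ := by
    intro h
    obtain ⟨ω, ω', hne⟩ := exists_pair_ne Ω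
    obtain ⟨g, hg⟩ := exists_smul_eq G ω ω'
    have h1 : g ∈ (⊥ : Subgroup G) := h ▸ Subgroup.mem_top g
    rw [Subgroup.mem_bot] at h1
    rw [h1, one_smul] at hg
    exact hne hg
  obtain ⟨M, ⟨hMn, hM0⟩, hM⟩ := wellFounded_lt.has_min
    {M : Subgroup G | M.Normal ∧ M ≠ ⊥} ⟨⊤, inferInstance, hG0⟩
  have hmin : ∀ N : Subgroup G, N.Normal → N ≤ M → N ≠ ⊥ → N = M := fun N hN hNM hN0 =>
    eq_of_le_of_not_lt hNM (hM N ⟨hN, hN0⟩)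
  have hMt : IsPretransitive M Ω := isPretransitive_of_normal_of_ne_bot M hM0
  by_cases hab : ∀ a b : M, a * b = b * a
  · right; left
    have hMnt : Nontrivial M := (Subgroup.nontrivial_iff_ne_bot M).2 hM0
    obtain ⟨r, hr, hrM⟩ := Nat.exists_prime_and_dvd (Finite.one_lt_card (α := M)).ne'
    obtain ⟨haff, d, hd⟩ := isAffineType_of_elementary_abelian hr M hab
      (forall_pow_eq_one_of_minimal_normal M hmin hab hr hrM)
    refine ⟨haff, d, ?_⟩
    -- Here `|Ω| = r ^ d`, so divisibility by `p` forces `r = p`.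
    rw [hd] at hpΩ
    rw [hd, (Nat.prime_dvd_prime_iff_eq hp hr).1 (hp.dvd_of_dvd_pow hpΩ)]
  · obtain ⟨T, hT, hTs, hTab, rfl⟩ := exists_isSimpleGroup_of_minimal_normal M hM0 hmin hab
    have hX : IsPretransitive (Subgroup.normalizer (T : Set G)) Ω := IsPretransitive.of_smul_eq
      (Subgroup.inclusion hT.normalClosure_le_normalizer) rfl
    have hT0 : T ≠ ⊥ := (Subgroup.nontrivial_iff_ne_bot T).1 inferInstance
    have hω : ∀ ω : Ω, ¬ T ≤ conjAgree (stabilizer G ω) T := fun ω =>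
      (hstar.subgroup hp _).not_le_conjAgree hp hTab (hT.prime_dvd_card (Ω := Ω) hp hpΩ) ω
        (hT.not_le_stabilizer hT0 ω)
    by_cases hn : Subgroup.normalizer (T : Set G) = ⊤
    · exact Or.inl (isAlmostSimple_of_normalizer_eq_top hTab hn (hω (Classical.arbitrary Ω)))
    · exact Or.inr (Or.inr (hT.isStarProductType hp hstar hTab hn hω))
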